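/- Definitions. A topological structure here is a zero-dimensional compact metrizable space with two closed binary relations $R,\le$; finite ones are discrete. An epimorphism $\varphi:A\to B$ is a continuous surjection with $R^B=(\varphi\times\varphi)[R^A]$ and $\le^B=(\varphi\times\varphi)[\le^A]$. Let $\mathcal F_0$ be the family of all finite structures $P$ such that $\le^P$ is a partial order, $a\mathrel{R^P}b$ holds if and only if $a=b$ or one of $a,b$ is an immediate $\le^P$-successor of the other, the graph of $R^P$ has no cycles, and the maximal chains of $\le^P$ are pairwise disjoint. A projective sequence from $\mathcal F_0$ consists of $P_n\in\mathcal F_0$ $(n\in\mathbb N)$ and epimorphisms $\varphi_n^{n+1}:P_{n+1}\to P_n$, with $\varphi_n^m$ $(m\ge n)$ their composites; its limit is $$\mathbb P=\Big\{u\in\prod_n P_n : u(n)=\varphi_n^{n+1}(u(n+1))\text{ for all }n\Big\},$$ where $R^{\mathbb P}$ and $\le^{\mathbb P}$ are defined coordinatewise, with projections $\varphi_n:\mathbb P\to P_n$. The sequence is fine if $R^{\mathbb P}$ is an equivalence relation. In that case let $p:\mathbb P\to\mathbb P/R^{\mathbb P}$ be the quotient map, let $\le^{\mathbb P/R^{\mathbb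 P}}=(p\times p)[\le^{\mathbb P}]$, and for $a\in P_n$ let $[\![a]\!]_{\varphi_n}=p[\varphi_n^{-1}(a)]$; the sequence approximates a compact metrizable space $X$ if $X$ is homeomorphic to $\mathbb P/R^{\mathbb P}$. A continuous map $f:X\to Z$ is irreducible if $f[K]\ne Z$ for every proper closed $K\subset X$. A fence is a compact metrizable space whose connected components are points or arcs. It is smooth if it carries a closed partial order whose restriction to each connected component is total. Such an order is strongly compatible if, moreover, two elements are comparable if and only if they lie in the same connected component. Theorem. Let $Y$ be a smooth fence with a strongly compatible order $\preceq$. Then there is a fine projective sequence $(P_n,\varphi_n^m)$ from $\mathcal F_0$ approximating $Y$ such that, with $\mathbb P$ its projective limit: a) the quotient map $p:\mathbb P\to\mathbb P/R^{\mathbb P}$ is irreducible; b) there is a homeomorphism $g:\mathbb P/R^{\mathbb P}\to Y$ that is also an order isomorphism between $\le^{\mathbb P/R^{\mathbb P}}$ and $\preceq$; c) for this $g$, for all $n\in\mathbb N$ and $a,a'\in P_n$, we have $a\le^{P_n}a'$ if and only if there are $x\in\operatorname{int}([\![a]\!]_{\varphi_n})$ and $x'\in\operatorname{int}([\![a']\!]_{\varphi_n})$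 with $g(x)\preceq g(x')$. -/

import Mathlib

open Set Topology TopologicalSpace

namespace HasseFence

universe u v

/-! ## Topological structures in the language with two binary relation symbols `R` and `≤` -/

/-- A topological structure in the language `{R, ≤}`: a zero-dimensional compact metrizable space
with closed binary relations `R` and `le` interpreting the two symbols. -/
structure TopStructure where
  carrier : Type u
  [topology : TopologicalSpace carrier]
  [compact : CompactSpace carrier]
  [metrizable : MetrizableSpace carrier]
  zeroDim : IsTopologicalBasis {s : Set carrier | IsClopen s}
  R : carrier → carrier → Prop
  le : carrier → carrier → Prop
  isClosed_R : IsClosed {x : carrier × carrier | R x.1 x.2}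
  isClosed_le : IsClosed {x : carrier × carrier | le x.1 x.2}

instance : CoeSort TopStructure.{u} (Type u) := ⟨TopStructure.carrier⟩

attribute [instance] TopStructure.topology TopStructure.compact TopStructure.metrizable

/-- Epimorphisms: continuous surjections `φ` such that each relation of `B` is the image under
`φ × φ` of the corresponding relation of `A`. -/
structure IsEpimorphism {A B : TopStructure.{u}} (φ : A → B) : Prop where
  continuous : Continuous φ
  surjective : Function.Surjective φ
  R_iff : ∀ b b' : B, B.R b b' ↔ ∃ a a' : A, φ a = b ∧ φ a' = b' ∧ A.R a a'
  le_iff : ∀ b b' : B, B.le b b' ↔ ∃ a a' : A, φ a = b ∧ φ a' = b' ∧ A.le a a'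

namespace TopStructure

/-- A prespace: `R` is an equivalence relation. -/
def IsPrespace (A : TopStructure.{u}) : Prop := Equivalence A.R

/-- The equivalence relation `R` of a prespace, as a setoid. -/
def setoidR (A : TopStructure.{u}) (h : A.IsPrespace) : Setoid A := ⟨A.R, h⟩

/-- The quotient space `A / R`, with the quotient topology. -/
abbrev QuotSpace (A : TopStructure.{u}) (h : A.IsPrespace) : Type u := Quotient (A.setoidR h)

/-- The quotient map `p : A → A / R`. -/
def proj (A : TopStructure.{u}) (h : A.IsPrespace) : A → A.QuotSpace h := Quotient.mk (A.setoidR h)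

/-- The relation induced by `≤` on `A / R`, namely the image of `≤` under `p × p`. -/
def quotLE (A : TopStructure.{u}) (h : A.IsPrespace) (x y : A.QuotSpace h) : Prop :=
  ∃ a b : A, A.proj h a = x ∧ A.proj h b = y ∧ A.le a b

/-- `b` is above `a`, with no element strictly in between
(either `a = b` or `b` is an immediate successor of `a`). -/
def Consecutive (P : TopStructure.{u}) (a b : P) : Prop :=
  P.le a b ∧ ∀ c : P, P.le a c → P.le c b → c = a ∨ c = b

/-- Hasse partial orders: `≤` is a partial order, and `R` is its Hasse diagram. -/
structure IsHPO (P : TopStructure.{u}) : Prop where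
  partialOrder : IsPartialOrder P P.le
  R_iff : ∀ a b : P, P.R a b ↔ a = b ∨ P.Consecutive a b ∨ P.Consecutive b a

/-- Hasse forests: Hasse partial orders whose Hasse diagram has no cycles. -/
structure IsHForest (P : TopStructure.{u}) : Prop extends P.IsHPO where
  acyclic : (SimpleGraph.fromRel P.R).IsAcyclic

/-- The family of all finite Hasse forests whose maximal chains are pairwise disjoint. -/
structure MemF₀ (P : TopStructure.{u}) : Prop extends P.IsHForest where
  finite : Finite P
  disjoint_chains : ∀ B B' : Set P, IsMaxChain P.le B → IsMaxChain P.le B' → B ≠ B' → Disjoint B B'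

end TopStructure

/-! ## Projective sequences and their limits -/

/-- A projective sequence of topological structures, given by its one-step epimorphisms
`P (n + 1) → P n`; the other bonding maps `P m → P n` are the composites of these. -/
structure ProjSequence where
  P : ℕ → TopStructure.{u}
  map : ∀ n, P (n + 1) → P n
  epi : ∀ n, IsEpimorphism (map n)

namespace ProjSequence

/-- The underlying set of the projective limit. -/
def limitSet (S : ProjSequence.{u}) : Set (∀ n, S.P n) := {w | ∀ n, w n = S.map n (w (n + 1))}

theorem isClosed_limitSet (S : ProjSequence.{u}) : IsClosed S.limitSet := by
  have h : S.limitSet = ⋂ n, {w : ∀ n, S.P n | w n = S.map n (w (n + 1))} := by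
    ext w; simp [limitSet]
  rw [h]
  exact isClosed_iInter fun n =>
    isClosed_eq (continuous_apply n) ((S.epi n).continuous.comp (continuous_apply (n + 1)))

theorem totallyDisconnected (A : TopStructure.{u}) : TotallyDisconnectedSpace A := by
  refine totallySeparatedSpace_iff_exists_isClopen.2 ?_ |>.totallyDisconnectedSpace
  intro x y hxy
  obtain ⟨s, hs, hxs, hsy⟩ := A.zeroDim.exists_subset_of_mem_open (show x ∈ ({y}ᶜ : Set A) from hxy)
    isOpen_compl_singleton
  exact ⟨s, hs, hxs, fun hy => hsy hy rfl⟩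

theorem secondCountable (A : TopStructure.{u}) : SecondCountableTopology A := by
  let := metrizableSpaceMetric A
  infer_instance

/-- The projective limit, as a topological structure. -/
def limit (S : ProjSequence.{u}) : TopStructure.{u} :=
  haveI : CompactSpace S.limitSet := isCompact_iff_compactSpace.1 S.isClosed_limitSet.isCompact
  haveI : ∀ n, SecondCountableTopology (S.P n) := fun n => secondCountable _
  haveI : ∀ n, TotallyDisconnectedSpace (S.P n) := fun n => totallyDisconnected _
  { carrier := S.limitSet
    zeroDim := isTopologicalBasis_isClopen
    R := fun w z => ∀ n, (S.P n).R (w.1 n) (z.1 n)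
    le := fun w z => ∀ n, (S.P n).le (w.1 n) (z.1 n)
    isClosed_R := by
      simp only [ofPred_forall]
      exact isClosed_iInter fun n => (S.P n).isClosed_R.preimage
        (f := fun x : S.limitSet × S.limitSet => (x.1.1 n, x.2.1 n)) (by
          exact ((continuous_apply n).comp (continuous_subtype_val.comp continuous_fst)).prodMk
            ((continuous_apply n).comp (continuous_subtype_val.comp continuous_snd)))
    isClosed_le := by
      simp only [ofPred_forall]
      exact isClosed_iInter fun n => (S.P n).isClosed_le.preimage
        (f := fun x : S.limitSet × S.limitSet => (x.1.1 n, x.2.1 n)) (by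
          exact ((continuous_apply n).comp (continuous_subtype_val.comp continuous_fst)).prodMk
            ((continuous_apply n).comp (continuous_subtype_val.comp continuous_snd))) }

/-- The projection of the limit onto the `n`-th structure. -/
def proj (S : ProjSequence.{u}) (n : ℕ) (w : S.limit) : S.P n := Subtype.val w n

/-- A projective sequence of finite structures is fine when its limit is a prespace. -/
def IsFine (S : ProjSequence.{u}) : Prop := (∀ n, Finite (S.P n)) ∧ S.limit.IsPrespace

/-- The sequence `S` approximates the compact metrizable space `X`. -/
def Approximates (S : ProjSequence.{u}) (h : S.IsFine) (X : Type v) [TopologicalSpace X] : Prop :=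
  CompactSpace X ∧ MetrizableSpace X ∧ Nonempty (S.limit.QuotSpace h.2 ≃ₜ X)

/-- For `a ∈ P n`, the set `p[φₙ⁻¹(a)]`, where `p` is the quotient map of the limit and `φₙ` is the
projection of the limit onto `P n`. -/
def cell (S : ProjSequence.{u}) (h : S.IsFine) (n : ℕ) (a : S.P n) : Set (S.limit.QuotSpace h.2) :=
  S.limit.proj h.2 '' {w | S.proj n w = a}

end ProjSequence

/-- A continuous map is irreducible if no proper closed subset is mapped onto the codomain. -/
def IsIrreducibleMap {X : Type u} {Y : Type v} [TopologicalSpace X] [TopologicalSpace Y]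
    (f : X → Y) : Prop :=
  Continuous f ∧ ∀ K : Set X, IsClosed K → K ≠ univ → f '' K ≠ univ

/-! ## Fences -/

/-- A fence: a compact metrizable space whose connected components are points or arcs. -/
structure IsFence (Y : Type v) [TopologicalSpace Y] : Prop where
  compact : CompactSpace Y
  metrizable : MetrizableSpace Y
  component : ∀ y : Y, connectedComponent y = {y} ∨ Nonempty (connectedComponent y ≃ₜ unitInterval)

/-- A closed partial order whose restriction to each connected component is total. -/
structure IsCompatibleOrder {Y : Type v} [TopologicalSpace Y] (r : Y → Y → Prop) : Prop where
  partialOrder : IsPartialOrder Y r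
  isClosed : IsClosed {x : Y × Y | r x.1 x.2}
  total : ∀ x y : Y, connectedComponent x = connectedComponent y → r x y ∨ r y x

/-- A smooth fence. -/
def IsSmoothFence (Y : Type v) [TopologicalSpace Y] : Prop :=
  IsFence Y ∧ ∃ r : Y → Y → Prop, IsCompatibleOrder r

/-- A strongly compatible order: moreover two elements are comparable if and only if they belong to
the same connected component. -/
structure IsStronglyCompatibleOrder {Y : Type v} [TopologicalSpace Y] (r : Y → Y → Prop) : Prop
    extends IsCompatibleOrder r where
  comparable_iff : ∀ x y : Y, (r x y ∨ r y x) ↔ connectedComponent x = connectedComponent y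

end HasseFence

/-! The order is encoded by a continuous `f : Y → ℝ`, injective on components: `r x y` holds exactly
when x and y share a component and `f x ≤ f y`. Cut Y by finer and finer clopen partitions `c n` and
by the first n terms of a dense sequence of levels `t`. The regions containing a regular point (one
off every level) are the cells. Within a piece they are ordered by height, so the finite order is a
disjoint union of chains. A thread of cells shrinks to one point of Y, and two threads are R-related
exactly when they give the same point (`limit_R_iff`); hence the limit modulo R is Y.

The difficulty is that comparable cells must be met by a common component
(`Cell.exists_regular_of_le`); the epimorphism property and (c) both rest on this. Two devices
achieve it. Each piece is made to contain a component touching all the half-spaces bounded by the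
current levels that the piece touches (`exists_isLocallyConstant_touched`). The levels are chosen
generically, so that a component touching two levels can be replaced by one crossing both strictly
(`exists_levels`). Genericity would fail if degenerate components alone filled an interval of
heights; `exists_countable_image_interior` removes this obstruction.

Crossing also makes the regular points dense (`dense_regular_of_crosses`). A regular point has only
one thread over it, whence irreducibility. -/

namespace HasseFence

/-! ### Clopen sets and locally constant choices in compact spaces -/

section ClopenSets

variable {Y : Type*} [TopologicalSpace Y]

theorem mem_of_connectedComponent_eq {D : Set Y} (hD : IsClopen D) {x y : Y}
    (h : connectedComponent x = connectedComponent y) (hx : x ∈ D) : y ∈ D :=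
  hD.connectedComponent_subset hx (h ▸ mem_connectedComponent)

variable [CompactSpace Y]

/-- In a compact Hausdorff space a component is the intersection of its clopen neighbourhoods, and
compactness of `Wᶜ` leaves finitely many of them. -/
theorem exists_isClopen_of_connectedComponent_subset [T2Space Y] {y : Y} {W : Set Y}
    (hW : IsOpen W) (h : connectedComponent y ⊆ W) : ∃ D, IsClopen D ∧ y ∈ D ∧ D ⊆ W := by
  have hK : IsCompact Wᶜ := hW.isClosed_compl.isCompact
  rw [connectedComponent_eq_iInter_isClopen] at h
  obtain ⟨F, hF⟩ := hK.elim_finite_subfamily_closed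
    (fun s : { s : Set Y // IsClopen s ∧ y ∈ s } => s.1) (fun s => s.2.1.1) (by
      rw [← disjoint_iff_inter_eq_empty]
      exact disjoint_compl_left_iff_subset.2 h)
  refine ⟨⋂ i ∈ F, i.1, isClopen_biInter_finset fun i _ => i.2.1, ?_, ?_⟩
  · exact mem_iInter₂.2 fun i _ => i.2.2
  · rw [← disjoint_iff_inter_eq_empty] at hF
    exact disjoint_compl_left_iff_subset.1 hF

/-- A choice, from a clopen neighbourhood assignment, of a locally constant function selecting
a neighbourhood of least weight from a finite subcover. -/
theorem exists_isLocallyConstant_selection (U : Y → Set Y) (hU : ∀ y, IsClopen (U y))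
    (hmem : ∀ y, y ∈ U y) (w : Y → ℕ) :
    ∃ φ : Y → Y, IsLocallyConstant φ ∧ (∀ y, y ∈ U (φ y)) ∧
      ∀ y z, y ∈ U (φ z) → w (φ y) ≤ w (φ z) := by
  classical
  rcases isEmpty_or_nonempty Y with hY | hY
  · exact ⟨id, fun s => by rw [eq_empty_of_isEmpty (id ⁻¹' s)]; exact isOpen_empty,
      isEmptyElim, isEmptyElim⟩
  obtain ⟨F, hF⟩ := isCompact_univ.elim_finite_subcover U (fun y => (hU y).isOpen)
    fun y _ => mem_iUnion.2 ⟨y, hmem y⟩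
  have hne : ∀ y, (F.filter fun z => y ∈ U z).Nonempty := fun y => by
    obtain ⟨z, hz, hyz⟩ := mem_iUnion₂.1 (hF (mem_univ y))
    exact ⟨z, Finset.mem_filter.2 ⟨hz, hyz⟩⟩
  have hψ : ∀ S : Finset Y, S.Nonempty → ∃ z ∈ S, ∀ z' ∈ S, w z ≤ w z' :=
    fun S hS => S.exists_min_image w hS
  -- The selection depends on `y` only through the finite set of `z ∈ F` with `y ∈ U z`, which is
  -- locally constant in `y`.
  choose! ψ hψS hψmin using hψ
  refine ⟨fun y => ψ (F.filter fun z => y ∈ U z), ?_, fun y => ?_, fun y z hy => ?_⟩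
  · rw [IsLocallyConstant.iff_exists_open]
    intro y
    refine ⟨⋂ z ∈ F, {y' | y' ∈ U z ↔ y ∈ U z}, isOpen_biInter_finset fun z _ => ?_,
      mem_iInter₂.2 fun z _ => Iff.rfl, fun y' hy' => ?_⟩
    · by_cases h : y ∈ U z
      · simpa [h] using (hU z).isOpen
      · simp only [h, iff_false]
        exact (hU z).compl.isOpen
    · have : (F.filter fun z => y' ∈ U z) = F.filter fun z => y ∈ U z :=
        Finset.filter_congr fun z hz => mem_iInter₂.1 hy' z hz
      exact congrArg ψ this
  · exact (Finset.mem_filter.1 (hψS _ (hne y))).2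
  · refine hψmin _ (hne y) _ (Finset.mem_filter.2 ⟨?_, hy⟩)
    exact (Finset.mem_filter.1 (hψS _ (hne z))).1

theorem countable_clopens [SecondCountableTopology Y] : Countable (Clopens Y) := by
  have h : ∀ s : Clopens Y, ∃ t : Finset (countableBasis Y),
      s.1 = ⋃₀ ((fun b => b.1) '' (t : Set (countableBasis Y))) := by
    intro s
    obtain ⟨t, ht⟩ := eq_sUnion_finset_of_isTopologicalBasis_of_isCompact_open _
        (isBasis_countableBasis Y) s.1 s.2.1.isCompact s.2.2
    exact ⟨t, by simpa using ht⟩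
  choose t ht using h
  refine Function.Injective.countable (f := t) fun s s' hs => ?_
  exact SetLike.coe_injective ((ht s).trans (hs ▸ (ht s').symm))

end ClopenSets

/-! ### Monotone functions on compact ordered spaces -/

section MonotoneFunctions

variable {Y : Type*} [TopologicalSpace Y] [CompactSpace Y] [T2Space Y] {r : Y → Y → Prop}

/-- Urysohn's lemma for compact partially ordered spaces. -/
theorem exists_monotone_zero_one (hp : IsPartialOrder Y r)
    (hc : IsClosed {x : Y × Y | r x.1 x.2}) {x y : Y} (h : ¬ r y x) :
    ∃ f : Y → ℝ, Continuous f ∧ (∀ a b, r a b → f a ≤ f b) ∧ (∀ a, f a ∈ Icc 0 1) ∧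
      f x = 0 ∧ f y = 1 := by
  have down : ∀ c : Set Y, IsClosed c → IsClosed {a | ∃ b ∈ c, r a b} := fun c hcl => by
    have := isClosedMap_fst_of_compactSpace _
      (hc.inter (hcl.preimage (continuous_snd (X := Y) (Y := Y))))
    convert this using 1
    ext a
    simp only [mem_ofPred_eq, mem_image, mem_inter_iff, mem_preimage, Prod.exists]
    grind
  have up : ∀ c : Set Y, IsClosed c → IsClosed {a | ∃ b ∈ c, r b a} := fun c hcl => by
    have := isClosedMap_snd_of_compactSpace _
      (hc.inter (hcl.preimage (continuous_fst (X := Y) (Y := Y))))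
    convert this using 1
    ext a
    simp only [mem_ofPred_eq, mem_image, mem_inter_iff, mem_preimage, Prod.exists]
    grind
  -- The predicate requires the open set of each pair to be a down-set, which makes all the Urysohn
  -- approximants monotone.
  let c : Urysohns.CU (fun _ u : Set Y => ∀ a b, r a b → b ∈ u → a ∈ u) :=
    { C := {a | ∃ b ∈ ({x} : Set Y), r a b}
      U := {a | ∃ b ∈ ({y} : Set Y), r b a}ᶜ
      P_C_U := by
        rintro a b hab hb ⟨z, hz, hza⟩
        exact hb ⟨z, hz, hp.trans _ _ _ hza hab⟩
      closed_C := down _ isClosed_singleton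
      open_U := (up _ isClosed_singleton).isOpen_compl
      subset := by
        rintro a ⟨b, rfl, hab⟩ ⟨z, rfl, hza⟩
        exact h (hp.trans _ _ _ hza hab)
      hP := by
        intro c u hcl hu huo hcu
        have hd : Disjoint {a | ∃ b ∈ c, r a b} uᶜ := by
          refine disjoint_compl_right_iff_subset.2 ?_
          rintro a ⟨b, hb, hab⟩
          exact hu a b hab (hcu hb)
        obtain ⟨A, B, hA, hB, hcA, huB, hAB⟩ :=
          normal_separation (down c hcl) huo.isClosed_compl hd
        -- Removing the up-closure of `Aᶜ` leaves the largest down-set inside `A`; it is open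
        -- because up-closures of closed sets are closed.
        have hvA : {a | ∃ b ∈ Aᶜ, r b a}ᶜ ⊆ A := fun z hz => by
          by_contra hzA
          exact hz ⟨z, hzA, hp.refl z⟩
        refine ⟨{a | ∃ b ∈ Aᶜ, r b a}ᶜ, (up _ hA.isClosed_compl).isOpen_compl, ?_, ?_, ?_, hu⟩
        · rintro z hz ⟨b, hb, hbz⟩
          exact hb (hcA ⟨z, hz, hbz⟩)
        · refine (closure_minimal (hvA.trans (disjoint_left.1 hAB)) hB.isClosed_compl).trans ?_
          exact compl_subset_comm.1 huB
        · rintro a b hab hb ⟨z, hz, hza⟩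
          exact hb ⟨z, hz, hp.trans _ _ _ hza hab⟩ }
  have mono : ∀ (n : ℕ) (c : Urysohns.CU (fun _ u : Set Y => ∀ a b, r a b → b ∈ u → a ∈ u))
      (a b : Y), r a b → c.approx n a ≤ c.approx n b := by
    intro n
    induction n with
    | zero =>
      intro c a b hab
      by_cases hb : b ∈ c.U
      · rw [Urysohns.CU.approx, Urysohns.CU.approx, indicator_of_notMem (notMem_compl_iff.2 hb),
          indicator_of_notMem (notMem_compl_iff.2 (c.P_C_U a b hab hb))]
      · rw [c.approx_of_notMem_U 0 hb]
        exact c.approx_le_one 0 a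
    | succ n ih =>
      intro c a b hab
      exact midpoint_le_midpoint (ih c.left a b hab) (ih c.right a b hab)
  refine ⟨c.lim, c.continuous_lim, fun a b hab => ?_, c.lim_mem_Icc, c.lim_of_mem_C x ?_,
    c.lim_of_notMem_U y ?_⟩
  · exact le_of_tendsto_of_tendsto' (c.tendsto_approx_atTop a) (c.tendsto_approx_atTop b)
      fun n => mono n c a b hab
  · exact ⟨x, rfl, hp.refl x⟩
  · exact not_not.2 ⟨y, rfl, hp.refl y⟩

/-- Second countability of `Y × Y` leaves countably many monotone functions that together separate
all strictly comparable pairs; a weighted sum of them is strictly monotone. -/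
theorem exists_strictMono_continuous [SecondCountableTopology Y] (hp : IsPartialOrder Y r)
    (hc : IsClosed {x : Y × Y | r x.1 x.2}) :
    ∃ f : Y → ℝ, Continuous f ∧ ∀ a b, r a b → a ≠ b → f a < f b := by
  choose! f fcont fmono f01 f0 f1 using
    fun p : {p : Y × Y // ¬ r p.2 p.1} => exists_monotone_zero_one hp hc p.2
  obtain ⟨T, hT, hTU⟩ := isOpen_iUnion_countable (fun p => {q : Y × Y | f p q.1 < f p q.2})
    fun p => isOpen_lt ((fcont p).comp continuous_fst) ((fcont p).comp continuous_snd)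
  have key : ∀ a b, r a b → a ≠ b → ∃ p ∈ T, f p a < f p b := fun a b hab hne => by
    have hba : ¬ r b a := fun h => hne (hp.antisymm _ _ hab h)
    have : (a, b) ∈ ⋃ p, {q : Y × Y | f p q.1 < f p q.2} :=
      mem_iUnion.2 ⟨⟨(a, b), hba⟩, by simp [f0 ⟨(a, b), hba⟩, f1 ⟨(a, b), hba⟩]⟩
    rw [← hTU] at this
    simpa using this
  rcases T.eq_empty_or_nonempty with rfl | hne
  · exact ⟨fun _ => 0, continuous_const, fun a b hab hne => by simpa using key a b hab hne⟩
  obtain ⟨g, rfl⟩ := hT.exists_eq_range hne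
  have hbound : ∀ n y, ‖(1 / 2 : ℝ) ^ n * f (g n) y‖ ≤ (1 / 2) ^ n := fun n y => by
    rw [norm_mul, Real.norm_of_nonneg (by positivity), Real.norm_of_nonneg (f01 _ _).1]
    exact mul_le_of_le_one_right (by positivity) (f01 _ _).2
  have hsum : ∀ y, Summable fun n => (1 / 2 : ℝ) ^ n * f (g n) y := fun y =>
    Summable.of_norm_bounded summable_geometric_two fun n => hbound n y
  refine ⟨fun y => ∑' n, (1 / 2 : ℝ) ^ n * f (g n) y,
    continuous_tsum (fun n => continuous_const.mul (fcont _)) summable_geometric_two hbound,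
    fun a b hab hne => ?_⟩
  obtain ⟨_, ⟨n, rfl⟩, hn⟩ := key a b hab hne
  refine Summable.tsum_lt_tsum (i := n) (fun m => ?_) ?_ (hsum a) (hsum b)
  · exact mul_le_mul_of_nonneg_left (fmono _ a b hab) (by positivity)
  · exact mul_lt_mul_of_pos_left hn (by positivity)

/-- A continuous function can be made to take countably many values on the interior of the set of
degenerate connected components, without changing it elsewhere. -/
theorem exists_countable_image_interior [SecondCountableTopology Y] {f : Y → ℝ}
    (hf : Continuous f) :
    ∃ g : Y → ℝ, Continuous g ∧ (∀ y, connectedComponent y ≠ {y} → g y = f y) ∧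
      (g '' interior {y | connectedComponent y = {y}}).Countable := by
  set O := interior {y : Y | connectedComponent y = {y}} with hO
  have hOc : ∀ y ∈ O, connectedComponent y = {y} := fun y hy =>
    interior_subset (s := {y : Y | connectedComponent y = {y}}) hy
  have cover : ∀ y ∈ O, ∃ D, IsClopen D ∧ y ∈ D ∧ D ⊆ O := fun y hy =>
    exists_isClopen_of_connectedComponent_subset isOpen_interior (by
      rw [hOc y hy]; exact singleton_subset_iff.2 hy)
  obtain ⟨E, hE, hEO⟩ : ∃ E : ℕ → Set Y, (∀ n, IsClopen (E n)) ∧ ⋃ n, E n = O := by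
    choose! D hD hyD hDO using cover
    obtain ⟨T, hTO, hT, hTU⟩ := isOpen_biUnion_countable O D fun y hy => (hD y hy).isOpen
    have hU : ⋃ y ∈ O, D y = O := (iUnion₂_subset hDO).antisymm fun y hy =>
      mem_iUnion₂.2 ⟨y, hy, hyD y hy⟩
    rcases T.eq_empty_or_nonempty with rfl | hne
    · refine ⟨fun _ => ∅, fun _ => isClopen_empty, ?_⟩
      rw [← hU, ← hTU]; simp
    · obtain ⟨e, rfl⟩ := hT.exists_eq_range hne
      refine ⟨fun n => D (e n), fun n => hD _ (hTO ⟨n, rfl⟩), ?_⟩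
      rw [← hU, ← hTU, biUnion_range]
  have hdis : ∀ n, IsClopen (disjointed E n) := fun n => by
    induction n with
    | zero => simpa using hE 0
    | succ n _ =>
      rw [disjointed_eq_inter_compl]
      exact (hE _).inter ((finite_lt_nat (n + 1)).isClopen_biInter fun i _ => (hE i).compl)
  have hdisO : ∀ n, disjointed E n ⊆ O := fun n =>
    (disjointed_subset E n).trans (hEO ▸ subset_iUnion E n)
  have happ : ∀ n, ∃ h : Y → ℝ, Continuous h ∧ (range h).Finite ∧
      ∀ y ∈ disjointed E n, |h y - f y| ≤ (1 / 2) ^ n := fun n => by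
    -- On the n-th piece components are points, so clopen sets of small oscillation exist. Elsewhere
    -- `U` avoids the piece, which forces points of the piece to select a centre inside it.
    have hU : ∀ y, ∃ U, IsClopen U ∧ y ∈ U ∧
        (y ∈ disjointed E n → ∀ z ∈ U, |f y - f z| ≤ (1 / 2) ^ n) ∧
        (y ∉ disjointed E n → Disjoint U (disjointed E n)) := fun y => by
      by_cases hy : y ∈ disjointed E n
      · obtain ⟨U, hUc, hyU, hUs⟩ := exists_isClopen_of_connectedComponent_subset
          (y := y) (W := {z | |f y - f z| < (1 / 2) ^ n})
          (isOpen_lt (continuous_const.sub hf).abs continuous_const) (by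
            rw [hOc y (hdisO n hy)]
            simp)
        exact ⟨U, hUc, hyU, fun _ z hz => (hUs hz).le, fun h => absurd hy h⟩
      · exact ⟨_, (hdis n).compl, hy, fun h => absurd h hy, fun _ => disjoint_compl_left⟩
    choose U hUc hyU hUa hUd using hU
    obtain ⟨φ, hφ, hφU, -⟩ := exists_isLocallyConstant_selection U hUc hyU fun _ => 0
    refine ⟨fun y => f (φ y), (hφ.comp f).continuous, (hφ.comp f).range_finite, fun y hy => ?_⟩
    by_cases h : φ y ∈ disjointed E n
    · exact hUa _ h y (hφU y)
    · exact absurd hy (disjoint_left.1 (hUd _ h) (hφU y))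
  choose h hcont hfin happ using happ
  have hterm : ∀ n, Continuous ((disjointed E n).indicator fun y => h n y - f y) := fun n =>
    ((hcont n).sub hf).indicator (by simp [(hdis n).frontier_eq])
  -- At most one term is nonzero at each point; the bound `(1 / 2) ^ n` gives continuity where the
  -- pieces accumulate.
  refine ⟨fun y => f y + ∑' n, (disjointed E n).indicator (fun y => h n y - f y) y,
    hf.add (continuous_tsum hterm summable_geometric_two fun n y => ?_), fun y hy => ?_, ?_⟩
  · by_cases hy : y ∈ disjointed E n
    · rw [indicator_of_mem hy]
      exact happ n y hy
    · simp [indicator_of_notMem hy]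
  · have : ∀ n, y ∉ disjointed E n := fun n hn => hy (hOc y (hdisO n hn))
    simp [this]
  · refine (countable_iUnion fun n => (hfin n).countable).mono ?_
    rintro _ ⟨y, hy, rfl⟩
    rw [← hEO, ← iUnion_disjointed] at hy
    obtain ⟨n, hn⟩ := mem_iUnion.1 hy
    refine mem_iUnion.2 ⟨n, y, ?_⟩
    change h n y = f y + ∑' n, _
    rw [tsum_eq_single n fun m hm => indicator_of_notMem (fun hm' =>
      disjoint_left.1 (disjoint_disjointed E hm) hm' hn) _, indicator_of_mem hn]
    ring

end MonotoneFunctions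

/-! ### Generic levels by Baire category -/

section Levels

variable {Y : Type*} [TopologicalSpace Y]

/-- A component attains every intermediate value, and a countable set cannot exhaust an open
interval. This supplies regular points in a prescribed window of heights. -/
theorem exists_mem_connectedComponent_of_lt {f : Y → ℝ} (hf : Continuous f) {t : Set ℝ}
    (ht : t.Countable) {x y : Y} (hxy : connectedComponent x = connectedComponent y) {a b : ℝ}
    (hab : a < b) (hx : f x ≤ a) (hy : b ≤ f y) :
    ∃ z, connectedComponent z = connectedComponent x ∧ a < f z ∧ f z < b ∧ f z ∉ t := by
  obtain ⟨v, ⟨hav, hvb⟩, hvt⟩ : (Ioo a b \ t).Nonempty := by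
    rw [sdiff_nonempty]
    exact fun h => (Cardinal.Real.Ioo_countable_iff.not.2 (not_le.2 hab)) (ht.mono h)
  obtain ⟨z, hz, rfl⟩ := (isPreconnected_connectedComponent (x := x)).intermediate_value
    mem_connectedComponent (hxy ▸ mem_connectedComponent) hf.continuousOn
    ⟨hx.trans hav.le, hvb.le.trans hy⟩
  exact ⟨z, (connectedComponent_eq hz).symm, hav, hvb, hvt⟩

/-- Some component contained in `D` reaches strictly below `s` and strictly above `t`. -/
def Crosses (f : Y → ℝ) (D : Set Y) (s t : ℝ) : Prop :=
  ∃ x ∈ D, ∃ y, connectedComponent x = connectedComponent y ∧ f x < s ∧ t < f y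

/-- Some component contained in `D` reaches down to `s` and up to `t`. -/
def Touches (f : Y → ℝ) (D : Set Y) (s t : ℝ) : Prop :=
  ∃ x ∈ D, ∃ y, connectedComponent x = connectedComponent y ∧ f x ≤ s ∧ t ≤ f y

variable {f : Y → ℝ}

/-- The pairs of levels for which some component touching both levels cannot be replaced, within
`D`, by one crossing both. -/
def badLevels (f : Y → ℝ) (D : Set Y) : Set (ℝ × ℝ) :=
  {p | p.1 ≤ p.2 ∧ Touches f D p.1 p.2 ∧ ¬ Crosses f D p.1 p.2}

/-- Once the lower level is raised and the upper one lowered, the touching component itself crosses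
strictly. -/
theorem shift_notMem_badLevels {D : Set Y} {s t x : ℝ} (h : (s, t) ∈ badLevels f D)
    (hx : 0 < x) : (s + x, t - x) ∉ badLevels f D := by
  rintro ⟨-, -, h2⟩
  obtain ⟨-, ⟨a, ha, b, hab, has, htb⟩, -⟩ := h
  dsimp only at *
  exact h2 ⟨a, ha, b, hab, by linarith, by linarith⟩

/-- If all these levels were bad, every component meeting `D ∩ f ⁻¹' Ioo a b` would be a point, so
`f` would take countably many values there; yet every bad level is attained. -/
theorem exists_diag_notMem_badLevels (hf : Continuous f)
    (hinj : ∀ x y, connectedComponent x = connectedComponent y → f x = f y → x = y)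
    (hcount : (f '' interior {y | connectedComponent y = {y}}).Countable) {D : Set Y}
    (hD : IsClopen D) {a b : ℝ} (hab : a < b) : ∃ t ∈ Ioo a b, (t, t) ∉ badLevels f D := by
  by_contra! h
  have hsing : D ∩ f ⁻¹' Ioo a b ⊆ interior {y | connectedComponent y = {y}} := by
    refine interior_maximal (fun y ⟨hyD, hya, hyb⟩ => ?_)
      (hD.isOpen.inter (isOpen_Ioo.preimage hf))
    refine subset_antisymm (fun z hz => ?_) (singleton_subset_iff.2 mem_connectedComponent)
    have hyz := connectedComponent_eq hz
    by_contra hne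
    rcases lt_trichotomy (f y) (f z) with hlt | heq | hlt
    · obtain ⟨v, hv1, hv2⟩ := exists_between (lt_min hlt hyb)
      exact (h v ⟨hya.trans hv1, hv2.trans_le (min_le_right _ _)⟩).2.2
        ⟨y, hyD, z, hyz, hv1, hv2.trans_le (min_le_left _ _)⟩
    · exact hne (hinj y z hyz heq).symm
    · obtain ⟨v, hv1, hv2⟩ := exists_between (max_lt hlt hya)
      exact (h v ⟨(le_max_right _ _).trans_lt hv1, hv2.trans hyb⟩).2.2
        ⟨z, mem_of_connectedComponent_eq hD hyz hyD, y, hyz.symm, (le_max_left _ _).trans_lt hv1,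
          hv2⟩
  refine (Cardinal.Real.Ioo_countable_iff.not.2 (not_le.2 hab)) (hcount.mono fun t ht => ?_)
  obtain ⟨-, ⟨x, hx, y, hxy, hxt, hty⟩, -⟩ := h t ht
  obtain ⟨z, hz, rfl⟩ := (isPreconnected_connectedComponent (x := x)).intermediate_value
    mem_connectedComponent (hxy ▸ mem_connectedComponent) hf.continuousOn ⟨hxt, hty⟩
  exact ⟨z, hsing ⟨mem_of_connectedComponent_eq hD (connectedComponent_eq hz) hx, ht⟩, rfl⟩

theorem isOpen_crosses (D : Set Y) : IsOpen {p : ℝ × ℝ | Crosses f D p.1 p.2} := by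
  have : {p : ℝ × ℝ | Crosses f D p.1 p.2} = ⋃ x ∈ D, ⋃ y,
      ⋃ (_ : connectedComponent x = connectedComponent y), Ioi (f x) ×ˢ Iio (f y) := by
    ext p; simp only [Crosses, mem_ofPred_eq, mem_iUnion, mem_prod, mem_Ioi, mem_Iio]; grind
  rw [this]
  exact isOpen_biUnion fun x _ => isOpen_iUnion fun y => isOpen_iUnion fun _ =>
    isOpen_Ioi.prod isOpen_Iio

variable [CompactSpace Y] [T2Space Y]

theorem isClosed_connectedComponent_eq :
    IsClosed {p : Y × Y | connectedComponent p.1 = connectedComponent p.2} := by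
  have := isClosed_eq (ConnectedComponents.continuous_coe.comp (continuous_fst (X := Y) (Y := Y)))
    (ConnectedComponents.continuous_coe.comp continuous_snd)
  simpa only [Function.comp_apply, ConnectedComponents.coe_eq_coe] using this

theorem isClosed_touches (hf : Continuous f) {D : Set Y} (hD : IsClosed D) :
    IsClosed {p : ℝ × ℝ | Touches f D p.1 p.2} := by
  have h1 : IsClosed {q : (ℝ × ℝ) × (Y × Y) | q.2.1 ∈ D ∧
      connectedComponent q.2.1 = connectedComponent q.2.2 ∧ f q.2.1 ≤ q.1.1 ∧ q.1.2 ≤ f q.2.2} :=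
    have hsnd := continuous_snd (X := ℝ × ℝ) (Y := Y × Y)
    have hfst := continuous_fst (X := ℝ × ℝ) (Y := Y × Y)
    (hD.preimage (continuous_fst.comp hsnd)).inter
      ((isClosed_connectedComponent_eq.preimage hsnd).inter
        ((isClosed_le (hf.comp (continuous_fst.comp hsnd)) (continuous_fst.comp hfst)).inter
          (isClosed_le (continuous_snd.comp hfst) (hf.comp (continuous_snd.comp hsnd)))))
  convert isClosedMap_fst_of_compactSpace _ h1 using 1
  ext p
  simp only [Touches, mem_ofPred_eq, mem_image, Prod.exists]
  grind

theorem isClosed_badLevels (hf : Continuous f) {D : Set Y} (hD : IsClosed D) :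
    IsClosed (badLevels f D) :=
  (isClosed_le continuous_fst continuous_snd).inter
    ((isClosed_touches hf hD).inter (isOpen_crosses D).isClosed_compl)

theorem isOpen_notMem_badLevels (hf : Continuous f) {D : Set Y} (hD : IsClosed D) (i j : ℕ) :
    IsOpen {t : ℕ → ℝ | (t i, t j) ∉ badLevels f D} :=
  (isClosed_badLevels hf hD).isOpen_compl.preimage
    ((continuous_apply (A := fun _ : ℕ => ℝ) i).prodMk (continuous_apply j))

open Filter in
-- Baire category in `ℕ → ℝ`: density of the range, and avoidance of bad pairs for each of the
-- countably many clopen sets, are dense Gδ conditions.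
theorem exists_levels [SecondCountableTopology Y] (hf : Continuous f)
    (hinj : ∀ x y, connectedComponent x = connectedComponent y → f x = f y → x = y)
    (hcount : (f '' interior {y | connectedComponent y = {y}}).Countable) :
    ∃ t : ℕ → ℝ, (∀ a b, a < b → ∃ i, a < t i ∧ t i < b) ∧
      ∀ D, IsClopen D → ∀ i j, t i ≤ t j → Touches f D (t i) (t j) → Crosses f D (t i) (t j) := by
  have := countable_clopens (Y := Y)
  have hupd : ∀ (t : ℕ → ℝ) (i : ℕ), Continuous fun v : ℝ => Function.update t i v :=
    fun t i => continuous_const.update i continuous_id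
  have h1 : Dense (⋂ p : ℚ × ℚ, {t : ℕ → ℝ | (p.1 : ℝ) < p.2 → ∃ i, (p.1 : ℝ) < t i ∧ t i < p.2}) ∧
      IsGδ (⋂ p : ℚ × ℚ, {t : ℕ → ℝ | (p.1 : ℝ) < p.2 → ∃ i, (p.1 : ℝ) < t i ∧ t i < p.2}) := by
    have ho : ∀ p : ℚ × ℚ,
        IsOpen {t : ℕ → ℝ | (p.1 : ℝ) < p.2 → ∃ i, (p.1 : ℝ) < t i ∧ t i < p.2} := fun p => by
      by_cases hp : (p.1 : ℝ) < p.2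
      · simp only [hp, true_imp_iff, ofPred_exists]
        exact isOpen_iUnion fun i => (isOpen_lt continuous_const (continuous_apply i)).inter
          (isOpen_lt (continuous_apply i) continuous_const)
      · simp [hp]
    refine ⟨dense_iInter_of_isOpen ho fun p t => ?_, .iInter_of_isOpen ho⟩
    by_cases hp : (p.1 : ℝ) < p.2
    · obtain ⟨v, hv⟩ := exists_between hp
      -- Altering only the n-th coordinate converges to `t` in the product topology as n grows.
      refine mem_closure_of_tendsto (f := fun n => Function.update t n v) (b := atTop)
        (tendsto_pi_nhds.2 fun i => ?_) (Eventually.of_forall fun n _ => ⟨n, by simpa using hv⟩)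
      refine tendsto_const_nhds.congr' ?_
      filter_upwards [eventually_gt_atTop i] with n hn
      rw [Function.update_of_ne hn.ne]
    · exact subset_closure fun h => absurd h hp
  have h2 : Dense (⋂ q : Clopens Y × ℕ × ℕ,
        {t : ℕ → ℝ | (t q.2.1, t q.2.2) ∉ badLevels f (q.1 : Set Y)}) := by
    refine dense_iInter_of_isOpen (fun q => ?_) fun ⟨D, i, j⟩ t => ?_
    · exact isOpen_notMem_badLevels hf q.1.isClopen.isClosed _ _
    by_cases hbad : (t i, t j) ∈ badLevels f (D : Set Y)
    swap
    · exact subset_closure hbad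
    -- On the diagonal the two levels cannot be shifted in opposite directions, so the countability
    -- argument is used there instead.
    rcases eq_or_ne i j with rfl | hij
    · have hcl : t i ∈ closure {v | (v, v) ∉ badLevels f (D : Set Y)} := by
        refine mem_closure_iff_nhds_basis (nhds_basis_Ioo (t i)) |>.2 fun p hp => ?_
        obtain ⟨v, hv, hvb⟩ := exists_diag_notMem_badLevels hf hinj hcount D.isClopen
          (hp.1.trans hp.2)
        exact ⟨v, hvb, hv⟩
      have := map_mem_closure (hupd t i) hcl (t := {t : ℕ → ℝ | (t i, t i) ∉ badLevels f (D : Set Y)})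
        fun v hv => by simpa using hv
      rwa [Function.update_eq_self] at this
    · have hcl : (0 : ℝ) ∈ closure (Ioi 0) := by simp
      have := map_mem_closure
        (f := fun x : ℝ => Function.update (Function.update t i (t i + x)) j (t j - x))
        ((continuous_const.update i (by fun_prop)).update j (by fun_prop)) hcl
        (t := {t : ℕ → ℝ | (t i, t j) ∉ badLevels f (D : Set Y)}) fun x hx => by
          simpa [Function.update_of_ne hij] using shift_notMem_badLevels hbad hx
      simpa using this
  have h2' : IsGδ (⋂ q : Clopens Y × ℕ × ℕ,
        {t : ℕ → ℝ | (t q.2.1, t q.2.2) ∉ badLevels f (q.1 : Set Y)}) :=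
    .iInter_of_isOpen fun q => isOpen_notMem_badLevels hf q.1.isClopen.isClosed _ _
  obtain ⟨t, ht1, ht2⟩ := (h1.1.inter_of_Gδ h1.2 h2' h2).nonempty
  refine ⟨t, fun a b hab => ?_, fun D hD i j hij htouch => ?_⟩
  · obtain ⟨p, hap, hpb⟩ := exists_rat_btwn hab
    obtain ⟨q, hpq, hqb⟩ := exists_rat_btwn hpb
    obtain ⟨i, hi1, hi2⟩ := mem_iInter.1 ht1 (p, q) hpq
    exact ⟨i, hap.trans hi1, hi2.trans hqb⟩
  · by_contra hc
    exact mem_iInter.1 ht2 (⟨D, hD⟩, i, j) ⟨hij, htouch, hc⟩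

end Levels

/-! ### Refining clopen partitions -/

section Labels

variable {Y : Type*} [TopologicalSpace Y]

/-- The indices `j < n` for which the component of `y` meets `Z j`. -/
noncomputable def touched (Z : ℕ → Set Y) (n : ℕ) (y : Y) : Finset ℕ :=
  open scoped Classical in
  (Finset.range n).filter fun j => ∃ z, connectedComponent z = connectedComponent y ∧ z ∈ Z j

theorem mem_touched {Z : ℕ → Set Y} {n : ℕ} {y : Y} {j : ℕ} : j ∈ touched Z n y ↔
    j < n ∧ ∃ z, connectedComponent z = connectedComponent y ∧ z ∈ Z j := by
  simp [touched]

variable [CompactSpace Y] [T2Space Y]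

/-- Every locally constant labelling can be refined so that each fibre of the refinement contains
a component which meets all those among `Z 0, …, Z (n - 1)` which are met by the fibre. -/
theorem exists_isLocallyConstant_touched (Z : ℕ → Set Y) (hZ : ∀ j, IsClosed (Z j)) (n : ℕ)
    {d : Y → ℕ} (hd : IsLocallyConstant d) :
    ∃ c : Y → ℕ, IsLocallyConstant c ∧ (∀ x y, c x = c y → d x = d y) ∧
      ∀ y, ∃ y₀, c y₀ = c y ∧ ∀ y', c y' = c y → touched Z n y' ⊆ touched Z n y₀ := by
  have hU : ∀ y, ∃ U, IsClopen U ∧ y ∈ U ∧ (∀ z ∈ U, d z = d y) ∧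
      ∀ z ∈ U, touched Z n z ⊆ touched Z n y := fun y => by
    obtain ⟨U, hUc, hyU, hU⟩ := exists_isClopen_of_connectedComponent_subset (y := y)
      (W := ⋂ j ∈ {j | j < n ∧ j ∉ touched Z n y}, (Z j)ᶜ)
      (((finite_lt_nat n).subset fun j hj => hj.1).isOpen_biInter fun j _ =>
        (hZ j).isOpen_compl)
      fun z hz => mem_iInter₂.2 fun j hj hzj =>
        hj.2 (mem_touched.2 ⟨hj.1, z, (connectedComponent_eq hz).symm, hzj⟩)
    refine ⟨U ∩ d ⁻¹' {d y}, hUc.inter (hd.isClopen_fiber _), ⟨hyU, rfl⟩, fun z hz => hz.2,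
      fun z hz j hj => ?_⟩
    by_contra hjy
    obtain ⟨hjn, x, hx, hxj⟩ := mem_touched.1 hj
    exact mem_iInter₂.1 (hU (mem_of_connectedComponent_eq hUc hx.symm hz.1)) j ⟨hjn, hjy⟩ hxj
  choose U hUc hmem hUd hUt using hU
  -- The binary code is monotone for inclusion and injective, so it serves both as a weight to
  -- minimise and as a label.
  let ρ : Finset ℕ → ℕ := fun s => ∑ k ∈ s, 2 ^ k
  have hρ : StrictMono fun s : Colex (Finset ℕ) => ρ (ofColex s) :=
    Finset.geomSum_ofColex_strictMono le_rfl
  have hρle : ∀ {s t : Finset ℕ}, s ⊆ t → ρ s ≤ ρ t := fun h =>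
    hρ.monotone (Finset.Colex.toColex_le_toColex_of_subset h)
  have hρinj : ∀ {s t : Finset ℕ}, ρ s = ρ t → s = t := fun h =>
    congrArg ofColex (hρ.injective (a₁ := toColex _) (a₂ := toColex _) h)
  obtain ⟨φ, hφ, hφU, hφmin⟩ :=
    exists_isLocallyConstant_selection U hUc hmem fun y => ρ (touched Z n y)
  have heq : ∀ x y, Nat.pair (d x) (ρ (touched Z n (φ x))) =
      Nat.pair (d y) (ρ (touched Z n (φ y))) → d x = d y ∧
        touched Z n (φ x) = touched Z n (φ y) := fun x y h => by
    rw [Nat.pair_eq_pair] at h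
    exact ⟨h.1, hρinj h.2⟩
  -- The centre `φ y` is the maximal point: minimality of the weight puts it in the fibre of `y`,
  -- and each point of the fibre touches no more than its own centre, whose touched set is common to
  -- the fibre.
  refine ⟨fun y => Nat.pair (d y) (ρ (touched Z n (φ y))),
    hd.comp₂ (hφ.comp fun z => ρ (touched Z n z)) Nat.pair, fun x y h => (heq x y h).1,
    fun y => ⟨φ y, ?_, fun y' hy' => ?_⟩⟩
  · rw [Nat.pair_eq_pair]
    exact ⟨(hUd _ _ (hφU y)).symm,
      (hφmin _ _ (hmem _)).antisymm (hρle (hUt _ _ (hφU (φ y))))⟩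
  · rw [← (heq _ _ hy').2]
    exact hUt _ _ (hφU y')

end Labels

/-- A continuous function `f` which is injective on components, a dense sequence of levels `t`, and
a sequence of finite clopen partitions into fibres of `c n`, each refining the preceding one. -/
structure Cuts (Y : Type*) [TopologicalSpace Y] where
  f : Y → ℝ
  t : ℕ → ℝ
  c : ℕ → Y → ℕ
  parent : ℕ → ℕ → ℕ
  continuous_f : Continuous f
  eq_of_f_eq : ∀ x y, connectedComponent x = connectedComponent y → f x = f y → x = y
  dense_t : ∀ a b, a < b → ∃ i, a < t i ∧ t i < b
  isLocallyConstant_c : ∀ n, IsLocallyConstant (c n)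
  c_eq : ∀ n y, c n y = parent n (c (n + 1) y)
  component_eq : ∀ x y, (∀ n, c n x = c n y) → connectedComponent x = connectedComponent y
  crosses : ∀ n x y i j, c n x = c n y → i < n → j < n → f x ≤ t i → t i ≤ t j → t j ≤ f y →
    Crosses f (c n ⁻¹' {c n x}) (t i) (t j)
  dense_regular : Dense {y | f y ∉ range t}

/-! ### Existence of a system of cuts -/

section Existence

variable {Y : Type*} [TopologicalSpace Y] [CompactSpace Y] [T2Space Y]

/-- Near a point on a level, some component of a small clopen set crosses that level. By
compactness, its points slightly above the level lie in the given neighbourhood, and some of them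
avoid all levels. -/
theorem dense_regular_of_crosses {f : Y → ℝ} (hf : Continuous f)
    (hinj : ∀ x y, connectedComponent x = connectedComponent y → f x = f y → x = y) {t : ℕ → ℝ}
    (hcross : ∀ D, IsClopen D → ∀ i, Touches f D (t i) (t i) → Crosses f D (t i) (t i)) :
    Dense {y | f y ∉ range t} := by
  intro y
  by_cases hy : f y ∈ range t
  swap
  · exact subset_closure hy
  obtain ⟨i, hi⟩ := hy
  refine mem_closure_iff.2 fun W hW hyW => ?_
  obtain ⟨D, hD, hyD, hDW⟩ := exists_isClopen_of_connectedComponent_subset (y := y)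
    (W := W ∪ {z | f z ≠ f y}) (hW.union (isOpen_ne_fun hf continuous_const)) fun z hz => by
      by_cases h : f z = f y
      · exact Or.inl (hinj y z (connectedComponent_eq hz) h.symm ▸ hyW)
      · exact Or.inr h
  have hK : IsClosed (f '' (D \ W)) :=
    ((hD.isClosed.sdiff hW).isCompact.image hf).isClosed
  have hyK : f y ∉ f '' (D \ W) := fun ⟨z, hz, hzy⟩ => (hDW hz.1).elim hz.2 fun h => h hzy
  obtain ⟨ε, hε, hball⟩ := Metric.isOpen_iff.1 hK.isOpen_compl _ hyK
  obtain ⟨a, ha, b, hab, hai, hib⟩ := hcross D hD i ⟨y, hyD, y, rfl, hi.ge, hi.le⟩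
  obtain ⟨z, hza, hz1, hz2, hzt⟩ := exists_mem_connectedComponent_of_lt hf (countable_range t) hab
    (lt_min hib (lt_add_of_pos_right (t i) hε)) hai.le (min_le_left _ _)
  have hzD := mem_of_connectedComponent_eq hD hza.symm ha
  refine ⟨z, ?_, hzt⟩
  by_contra hzW
  refine hball ?_ ⟨z, ⟨hzD, hzW⟩, rfl⟩
  rw [Metric.mem_ball, Real.dist_eq, ← hi, abs_of_pos (sub_pos.2 hz1)]
  linarith [hz2.trans_le (min_le_right _ _)]

theorem exists_cuts [SecondCountableTopology Y] {r : Y → Y → Prop}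
    (hr : IsStronglyCompatibleOrder r) : ∃ C : Cuts Y,
      ∀ x y, r x y ↔ connectedComponent x = connectedComponent y ∧ C.f x ≤ C.f y := by
  obtain ⟨f₀, hf₀, hf₀lt⟩ := exists_strictMono_continuous hr.partialOrder hr.isClosed
  obtain ⟨f, hf, hff₀, hcount⟩ := exists_countable_image_interior hf₀
  have hlt : ∀ x y, r x y → x ≠ y → f x < f y := fun x y hxy hne => by
    have hcomp := (hr.comparable_iff x y).1 (Or.inl hxy)
    rw [hff₀ x fun h => hne ?_, hff₀ y fun h => hne ?_]
    · exact hf₀lt x y hxy hne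
    · have : x ∈ connectedComponent y := hcomp ▸ mem_connectedComponent
      rwa [h, mem_singleton_iff] at this
    · have : y ∈ connectedComponent x := hcomp ▸ mem_connectedComponent
      rw [h, mem_singleton_iff] at this
      exact this.symm
  have hinj : ∀ x y, connectedComponent x = connectedComponent y → f x = f y → x = y :=
    fun x y hxy hf => by
      by_contra hne
      rcases (hr.comparable_iff x y).2 hxy with h | h
      · exact (hlt x y h hne).ne hf
      · exact (hlt y x h (Ne.symm hne)).ne hf.symm
  have hriff : ∀ x y, r x y ↔ connectedComponent x = connectedComponent y ∧ f x ≤ f y := by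
    refine fun x y => ⟨fun h => ⟨(hr.comparable_iff x y).1 (Or.inl h), ?_⟩, fun ⟨h, hle⟩ => ?_⟩
    · rcases eq_or_ne x y with rfl | hne
      · exact le_rfl
      · exact (hlt x y h hne).le
    · rcases (hr.comparable_iff x y).2 h with h' | h'
      · exact h'
      · rcases eq_or_ne x y with rfl | hne
        · exact h'
        · exact absurd (hlt y x h' hne.symm) hle.not_gt
  obtain ⟨t, ht, hcross⟩ := exists_levels hf hinj hcount
  have := countable_clopens (Y := Y)
  obtain ⟨B, hB⟩ := exists_surjective_nat (Clopens Y)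
  classical
  -- Even indices code the half-spaces below a level and odd ones those above, so the first `2 * (n
  -- + 1)` sets belong to levels 0 to n.
  let Z : ℕ → Set Y := fun j => if j % 2 = 0 then {y | f y ≤ t (j / 2)} else {y | t (j / 2) ≤ f y}
  have hZ : ∀ j, IsClosed (Z j) := fun j => by
    by_cases hj : j % 2 = 0
    · simpa only [Z, hj, if_true] using isClosed_le hf continuous_const
    · simpa only [Z, hj, if_false] using isClosed_le continuous_const hf
  have step : ∀ (n : ℕ) (d : {d : Y → ℕ // IsLocallyConstant d}),
      ∃ c : {c : Y → ℕ // IsLocallyConstant c}, (∀ x y, c.1 x = c.1 y → d.1 x = d.1 y) ∧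
        (∀ x y, c.1 x = c.1 y → x ∈ B n → y ∈ B n) ∧
        ∀ y, ∃ y₀, c.1 y₀ = c.1 y ∧ ∀ y', c.1 y' = c.1 y →
          touched Z (2 * (n + 1)) y' ⊆ touched Z (2 * (n + 1)) y₀ := by
    rintro n ⟨d, hd⟩
    have hBn : IsLocallyConstant fun y => if y ∈ B n then 1 else 0 := by
      rw [IsLocallyConstant.iff_continuous]
      exact continuous_const.if (by
        change ∀ a ∈ frontier (B n : Set Y), _
        simp [(B n).isClopen.frontier_eq]) continuous_const
    obtain ⟨c, hc, hcd, hct⟩ := exists_isLocallyConstant_touched Z hZ (2 * (n + 1))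
      (hd.comp₂ hBn Nat.pair)
    refine ⟨⟨c, hc⟩, fun x y h => (Nat.pair_eq_pair.1 (hcd x y h)).1, fun x y h hx => ?_, hct⟩
    have := (Nat.pair_eq_pair.1 (hcd x y h)).2
    by_contra hy
    simp [hx, hy] at this
  choose next hnext hnextB hnextZ using step
  -- Passing from `c n` to `c (n + 1)` also splits along the n-th clopen set, so all the labels
  -- together separate components.
  let c : ℕ → {c : Y → ℕ // IsLocallyConstant c} := fun n =>
    Nat.rec ⟨fun _ => 0, IsLocallyConstant.const 0⟩ next n
  have hparent : ∀ n, ∃ g : ℕ → ℕ, ∀ y, (c n).1 y = g ((c (n + 1)).1 y) := fun n =>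
    ⟨fun k => if h : ∃ y, (c (n + 1)).1 y = k then (c n).1 h.choose else 0, fun y => by
      have h : ∃ y', (c (n + 1)).1 y' = (c (n + 1)).1 y := ⟨y, rfl⟩
      simp only [dif_pos h]
      exact hnext n (c n) _ _ h.choose_spec.symm⟩
  choose parent hparent using hparent
  refine ⟨⟨f, t, fun n => (c n).1, parent, hf, hinj, ht, fun n => (c n).2, hparent,
    fun x y hxy => ?_, fun n x y i j hxy hi hj hxi hij hjy => ?_,
    dense_regular_of_crosses hf hinj fun D hD i => hcross D hD i i le_rfl⟩, hriff⟩
  · refine (connectedComponent_eq ?_).symm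
    rw [connectedComponent_eq_iInter_isClopen]
    refine mem_iInter.2 fun ⟨D, hD, hyD⟩ => ?_
    obtain ⟨n, hn⟩ := hB ⟨D, hD⟩
    have := hnextB n (c n) y x (hxy (n + 1)).symm
    rw [hn] at this
    exact this hyD
  · obtain ⟨n, rfl⟩ := Nat.exists_eq_add_of_lt (Nat.zero_lt_of_lt hi)
    rw [zero_add] at *
    obtain ⟨y₀, hy₀, hmax⟩ := hnextZ n (c n) x
    have h1 : 2 * i ∈ touched Z (2 * (n + 1)) x :=
      mem_touched.2 ⟨by omega, x, rfl, by simpa [Z] using hxi⟩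
    have h2 : 2 * j + 1 ∈ touched Z (2 * (n + 1)) y :=
      mem_touched.2 ⟨by omega, y, rfl, by
        have : (2 * j + 1) / 2 = j := by omega
        simpa [Z, Nat.add_mod, this] using hjy⟩
    -- Although x and y may lie in different components, the component of `y₀` meets both
    -- half-spaces.
    obtain ⟨-, z₁, hz₁, hz₁i⟩ := mem_touched.1 (hmax x rfl h1)
    obtain ⟨-, z₂, hz₂, hz₂j⟩ := mem_touched.1 (hmax y hxy.symm h2)
    have hz₁i' : f z₁ ≤ t i := by simpa [Z] using hz₁i
    have hz₂j' : t j ≤ f z₂ := by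
      have : (2 * j + 1) / 2 = j := by omega
      simpa [Z, Nat.add_mod, this] using hz₂j
    have hclopen : IsClopen ((c (n + 1)).1 ⁻¹' {(c (n + 1)).1 x}) := (c (n + 1)).2.isClopen_fiber _
    exact hcross _ hclopen i j hij ⟨z₁, mem_of_connectedComponent_eq hclopen hz₁.symm hy₀, z₂,
      hz₁.trans hz₂.symm, hz₁i', hz₂j'⟩

end Existence

/-! ### Cells, their order and their Hasse diagram -/

namespace Cuts

variable {Y : Type*} [TopologicalSpace Y] (C : Cuts Y)

/-- A point is regular if it does not lie on any level. -/
def Regular (y : Y) : Prop := C.f y ∉ range C.t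

/-- The indices of the first `n` levels which lie below `y`. -/
noncomputable def below (n : ℕ) (y : Y) : Finset ℕ :=
  open scoped Classical in (Finset.range n).filter fun i => C.t i < C.f y

theorem mem_below {n : ℕ} {y : Y} {i : ℕ} : i ∈ C.below n y ↔ i < n ∧ C.t i < C.f y := by
  simp [below]

theorem below_mono {n : ℕ} {x y : Y} (h : C.f x ≤ C.f y) : C.below n x ⊆ C.below n y :=
  fun _ hi => C.mem_below.2 ⟨(C.mem_below.1 hi).1, (C.mem_below.1 hi).2.trans_le h⟩

theorem c_eq_of_component {n : ℕ} {x y : Y} (h : connectedComponent x = connectedComponent y) :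
    C.c n x = C.c n y :=
  (mem_of_connectedComponent_eq ((C.isLocallyConstant_c n).isClopen_fiber (C.c n x)) h rfl).symm

/-- The cells of the `n`-th partition: a cell is given by a piece of the clopen partition and the
set of the levels below it. -/
def Cell (n : ℕ) : Type := {p : ℕ × Finset ℕ // ∃ y, C.Regular y ∧ (C.c n y, C.below n y) = p}

variable {C}

/-- The cell containing a regular point. -/
noncomputable def cellOf (n : ℕ) {y : Y} (hy : C.Regular y) : C.Cell n :=
  ⟨(C.c n y, C.below n y), y, hy, rfl⟩

theorem exists_cellOf_eq {n : ℕ} (a : C.Cell n) : ∃ (y : Y) (hy : C.Regular y), cellOf n hy = a := by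
  obtain ⟨p, y, hy, hp⟩ := a
  exact ⟨y, hy, Subtype.ext hp⟩

namespace Cell

variable {n : ℕ}

/-- The piece of the clopen partition containing the cell. -/
def piece (a : C.Cell n) : ℕ := a.1.1

/-- The set of the levels below the cell. -/
def lower (a : C.Cell n) : Finset ℕ := a.1.2

@[ext] theorem ext {a b : C.Cell n} (h₁ : a.piece = b.piece) (h₂ : a.lower = b.lower) : a = b :=
  Subtype.ext (Prod.ext h₁ h₂)

theorem lt_of_mem_lower {a : C.Cell n} {i : ℕ} (h : i ∈ a.lower) : i < n := by
  obtain ⟨y, hy, rfl⟩ := exists_cellOf_eq a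
  exact (C.mem_below.1 h).1

theorem lower_total (a b : C.Cell n) : a.lower ⊆ b.lower ∨ b.lower ⊆ a.lower := by
  obtain ⟨x, hx, rfl⟩ := exists_cellOf_eq a
  obtain ⟨y, hy, rfl⟩ := exists_cellOf_eq b
  exact (le_total (C.f x) (C.f y)).imp C.below_mono C.below_mono

/-- Cells are comparable if they lie in the same piece, and then they are ordered by height. -/
def le (a b : C.Cell n) : Prop := a.piece = b.piece ∧ a.lower ⊆ b.lower

theorem le_refl (a : C.Cell n) : a.le a := ⟨rfl, subset_rfl⟩

instance : Std.Refl (le : C.Cell n → C.Cell n → Prop) := ⟨le_refl⟩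

theorem le_trans {a b c : C.Cell n} (h : a.le b) (h' : b.le c) : a.le c :=
  ⟨h.1.trans h'.1, h.2.trans h'.2⟩

theorem le_antisymm {a b : C.Cell n} (h : a.le b) (h' : b.le a) : a = b :=
  ext h.1 (h.2.antisymm h'.2)

/-- `b` is equal to `a` or an immediate successor of `a`. -/
def Consec (a b : C.Cell n) : Prop := a.le b ∧ ∀ e : C.Cell n, a.le e → e.le b → e = a ∨ e = b

/-- The Hasse diagram of the order on cells. -/
def Hasse (a b : C.Cell n) : Prop := a = b ∨ a.Consec b ∨ b.Consec a

/-- Representatives of the two cells may lie in different components. When the cells differ, a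
component of the piece crosses both the lowest and the highest level between them; its points just
below the former and just above the latter replace them. -/
theorem exists_regular_of_le {a b : C.Cell n} (h : a.le b) :
    ∃ (x y : Y) (hx : C.Regular x) (hy : C.Regular y), connectedComponent x = connectedComponent y ∧
      C.f x ≤ C.f y ∧ cellOf n hx = a ∧ cellOf n hy = b := by
  obtain ⟨x, hx, rfl⟩ := exists_cellOf_eq a
  obtain ⟨y, hy, rfl⟩ := exists_cellOf_eq b
  obtain ⟨hc, hl⟩ : C.c n x = C.c n y ∧ C.below n x ⊆ C.below n y := h
  by_cases hl' : C.below n y ⊆ C.below n x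
  · exact ⟨x, x, hx, hx, rfl, le_rfl, rfl, ext hc (hl.antisymm hl')⟩
  have hne : (C.below n y \ C.below n x).Nonempty := Finset.sdiff_nonempty.2 hl'
  obtain ⟨i, hi, himin⟩ := Finset.exists_min_image _ C.t hne
  obtain ⟨j, hj, hjmax⟩ := Finset.exists_max_image _ C.t hne
  rw [Finset.mem_sdiff, mem_below, mem_below, not_and, not_lt] at hi hj
  obtain ⟨⟨hin, hiy⟩, hix⟩ := hi
  obtain ⟨⟨hjn, hjy⟩, hjx⟩ := hj
  have hij : C.t i ≤ C.t j := himin j (by simp [mem_below, *])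
  obtain ⟨z, hz, w, hzw, hzi, hjw⟩ := C.crosses n x y i j hc hin hjn (hix hin) hij hjy.le
  have hbx : ∀ k < n, (C.t k < C.t i ↔ C.t k < C.f x) := fun k hk => by
    refine ⟨fun hki => ?_, fun hkx => hkx.trans_le (hix hin)⟩
    by_contra hkx
    exact hki.not_ge (himin k (by simp [mem_below, hk, hkx, hki.trans hiy]))
  have hby : ∀ k < n, (C.t k ≤ C.t j ↔ C.t k < C.f y) := fun k hk => by
    refine ⟨fun hkj => hkj.trans_lt hjy, fun hky => ?_⟩
    by_contra hkj
    have hkx : ¬ C.t k < C.f x := fun hkx => hkj ((hkx.trans_le (hix hin)).trans_le hij).le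
    exact hkj (hjmax k (by simp [mem_below, hk, hky, hkx]))
  -- No level of index below n lies strictly between `a` and `C.t i`, so any height in this window
  -- has the same levels below it as `x`.
  have hlow : ∃ a < C.t i, C.f z ≤ a ∧ ∀ k < n, C.t k < C.t i → C.t k ≤ a := by
    classical
    obtain ⟨a, ha, hamax⟩ := Finset.exists_max_image (insert (C.f z)
      (((Finset.range n).filter fun k => C.t k < C.t i).image C.t)) id (Finset.insert_nonempty _ _)
    refine ⟨a, ?_, hamax _ (Finset.mem_insert_self _ _), fun k hk hki =>
      hamax _ (Finset.mem_insert_of_mem (Finset.mem_image_of_mem _ (by simp [hk, hki])))⟩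
    rcases Finset.mem_insert.1 ha with rfl | ha
    · exact hzi
    · obtain ⟨k, hk, rfl⟩ := Finset.mem_image.1 ha
      exact (Finset.mem_filter.1 hk).2
  have hhigh : ∃ b > C.t j, b ≤ C.f w ∧ ∀ k < n, C.t j < C.t k → b ≤ C.t k := by
    classical
    obtain ⟨b, hb, hbmin⟩ := Finset.exists_min_image (insert (C.f w)
      (((Finset.range n).filter fun k => C.t j < C.t k).image C.t)) id (Finset.insert_nonempty _ _)
    refine ⟨b, ?_, hbmin _ (Finset.mem_insert_self _ _), fun k hk hki =>
      hbmin _ (Finset.mem_insert_of_mem (Finset.mem_image_of_mem _ (by simp [hk, hki])))⟩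
    rcases Finset.mem_insert.1 hb with rfl | hb
    · exact hjw
    · obtain ⟨k, hk, rfl⟩ := Finset.mem_image.1 hb
      exact (Finset.mem_filter.1 hk).2
  obtain ⟨a, hai, hza, hal⟩ := hlow
  obtain ⟨b, hbj, hbw, hbl⟩ := hhigh
  obtain ⟨x', hx'z, hx'a, hx'i, hx't⟩ := exists_mem_connectedComponent_of_lt C.continuous_f
    (countable_range C.t) hzw hai hza (hij.trans hjw.le)
  obtain ⟨y', hy'z, hy'j, hy'b, hy't⟩ := exists_mem_connectedComponent_of_lt C.continuous_f
    (countable_range C.t) hzw hbj (hzi.le.trans hij) hbw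
  refine ⟨x', y', hx't, hy't, hx'z.trans hy'z.symm, (hx'i.trans_le hij).le.trans hy'j.le,
    ext ((C.c_eq_of_component hx'z).trans hz) ?_,
    ext ((C.c_eq_of_component hy'z).trans (Eq.trans hz hc)) ?_⟩
  · refine Finset.ext fun k => ?_
    change k ∈ C.below n x' ↔ k ∈ C.below n x
    rw [mem_below, mem_below]
    refine and_congr_right fun hk => ?_
    rw [← hbx k hk]
    exact ⟨fun h => h.trans hx'i, fun h => (hal k hk h).trans_lt hx'a⟩
  · refine Finset.ext fun k => ?_
    change k ∈ C.below n y' ↔ k ∈ C.below n y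
    rw [mem_below, mem_below]
    refine and_congr_right fun hk => ?_
    rw [← hby k hk]
    exact ⟨fun h => not_lt.1 fun h' => (hbl k hk h').not_gt (h.trans hy'b),
      fun h => h.trans_lt hy'j⟩

theorem cellOf_le {x y : Y} {hx : C.Regular x} {hy : C.Regular y}
    (h : connectedComponent x = connectedComponent y) (hf : C.f x ≤ C.f y) :
    (cellOf n hx).le (cellOf n hy) :=
  ⟨C.c_eq_of_component h, C.below_mono hf⟩

/-- At most one level separates two consecutive cells. -/
theorem Consec.not_level_lt {a b : C.Cell n} (h : a.Consec b) {i j : ℕ} (hia : i ∉ a.lower)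
    (hib : i ∈ b.lower) (hja : j ∉ a.lower) (hjb : j ∈ b.lower) : ¬ C.t i < C.t j := by
  intro hij
  obtain ⟨x, y, hx, hy, hxy, hf, rfl, rfl⟩ := exists_regular_of_le h.1
  have hin := lt_of_mem_lower hib
  have hxi : C.f x ≤ C.t i := not_lt.1 fun hlt => hia (C.mem_below.2 ⟨hin, hlt⟩)
  have hjy : C.t j < C.f y := (C.mem_below.1 hjb).2
  obtain ⟨z, hzx, hiz, hzj, hz⟩ := exists_mem_connectedComponent_of_lt C.continuous_f
    (countable_range C.t) hxy hij hxi hjy.le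
  rcases h.2 (cellOf n hz) (cellOf_le hzx.symm (hxi.trans hiz.le))
    (cellOf_le (hzx.trans hxy) (hzj.trans hjy).le) with he | he
  · exact hia (he ▸ C.mem_below.2 ⟨hin, hiz⟩)
  · have : j ∈ (cellOf n hz).lower := he ▸ hjb
    exact hzj.not_gt (C.mem_below.1 this).2

theorem finite [CompactSpace Y] : Finite (C.Cell n) := by
  have := (C.isLocallyConstant_c n).range_finite.to_subtype
  refine Finite.of_injective (β := range (C.c n) × (Finset.range n).powerset)
    (fun a => ⟨⟨a.piece, ?_⟩, ⟨a.lower, ?_⟩⟩) fun a b h => ?_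
  · obtain ⟨y, hy, rfl⟩ := exists_cellOf_eq a
    exact ⟨y, rfl⟩
  · exact Finset.mem_powerset.2 fun i hi => Finset.mem_range.2 (lt_of_mem_lower hi)
  · simp only [Prod.mk.injEq, Subtype.mk.injEq] at h
    exact ext h.1 h.2

/-- The cell of the `n`-th partition containing a given cell of the next one. -/
def map (a : C.Cell (n + 1)) : C.Cell n :=
  ⟨(C.parent n a.piece, a.lower.filter (· < n)), by
    obtain ⟨y, hy, rfl⟩ := exists_cellOf_eq a
    refine ⟨y, hy, Prod.ext (C.c_eq n y) (Finset.ext fun i => ?_)⟩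
    change i ∈ C.below n y ↔ i ∈ (C.below (n + 1) y).filter (· < n)
    rw [Finset.mem_filter, mem_below, mem_below]
    grind⟩

theorem map_cellOf {y : Y} (hy : C.Regular y) : (cellOf (n + 1) hy).map = cellOf n hy := by
  refine ext (C.c_eq n y).symm (Finset.ext fun i => ?_)
  change i ∈ (C.below (n + 1) y).filter (· < n) ↔ i ∈ C.below n y
  rw [Finset.mem_filter, mem_below, mem_below]
  grind

theorem map_surjective : Function.Surjective (map : C.Cell (n + 1) → C.Cell n) := fun a => by
  obtain ⟨y, hy, rfl⟩ := exists_cellOf_eq a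
  exact ⟨cellOf (n + 1) hy, map_cellOf hy⟩

theorem map_le {a b : C.Cell (n + 1)} (h : a.le b) : a.map.le b.map :=
  ⟨congrArg (C.parent n) h.1, Finset.filter_subset_filter _ h.2⟩

theorem exists_le_of_le {a b : C.Cell n} (h : a.le b) :
    ∃ p q : C.Cell (n + 1), p.map = a ∧ q.map = b ∧ p.le q := by
  obtain ⟨x, y, hx, hy, hxy, hf, rfl, rfl⟩ := exists_regular_of_le h
  exact ⟨cellOf _ hx, cellOf _ hy, map_cellOf hx, map_cellOf hy, cellOf_le hxy hf⟩

/-- A component joining `p` to `q` attains the height of any coarse cell strictly between their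
images; the finer cell at that point lies between `p` and `q`, hence is one of them. -/
theorem Consec.map {p q : C.Cell (n + 1)} (h : p.Consec q) : p.map.Consec q.map := by
  refine ⟨map_le h.1, fun e hpe heq => ?_⟩
  obtain ⟨x, y, hx, hy, hxy, hf, rfl, rfl⟩ := exists_regular_of_le h.1
  obtain ⟨z, hz, rfl⟩ := exists_cellOf_eq e
  rw [map_cellOf] at hpe heq ⊢
  rw [map_cellOf]
  rcases le_or_gt (C.f z) (C.f x) with hzx | hxz
  · exact Or.inl (ext hpe.1.symm ((C.below_mono hzx).antisymm hpe.2))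
  rcases le_or_gt (C.f y) (C.f z) with hyz | hzy
  · exact Or.inr (ext heq.1 (heq.2.antisymm (C.below_mono hyz)))
  obtain ⟨w, hw, hwz⟩ := (isPreconnected_connectedComponent (x := x)).intermediate_value
    mem_connectedComponent (hxy ▸ mem_connectedComponent) C.continuous_f.continuousOn
    ⟨hxz.le, hzy.le⟩
  have hwx := (connectedComponent_eq hw).symm
  have hwr : C.Regular w := by rw [Regular, hwz]; exact hz
  have hwe : cellOf n hwr = cellOf n hz :=
    ext ((C.c_eq_of_component hwx).trans hpe.1)
      ((C.below_mono hwz.le).antisymm (C.below_mono hwz.ge))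
  rw [← hwe, ← map_cellOf hwr, ← map_cellOf hx, ← map_cellOf hy]
  exact (h.2 (cellOf _ hwr) (cellOf_le hwx.symm (hwz ▸ hxz.le))
    (cellOf_le (hwx.trans hxy) (hwz ▸ hzy.le))).imp (congrArg Cell.map) (congrArg Cell.map)

/-- A comparable lift with the fewest separating levels is consecutive: an intermediate cell maps to
`a` or `b` and could replace an end. -/
theorem Consec.exists_lift [CompactSpace Y] {a b : C.Cell n} (h : a.Consec b) :
    ∃ p q : C.Cell (n + 1), p.map = a ∧ q.map = b ∧ p.Consec q := by
  have := finite (C := C) (n := n + 1)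
  obtain ⟨p₀, q₀, hp₀, hq₀, hpq₀⟩ := exists_le_of_le h.1
  obtain ⟨⟨p, q⟩, ⟨hp, hq, hpq⟩, hmin⟩ := exists_min_image
    {s : C.Cell (n + 1) × C.Cell (n + 1) | s.1.map = a ∧ s.2.map = b ∧ s.1.le s.2}
    (fun s => s.2.lower.card - s.1.lower.card) (toFinite _) ⟨(p₀, q₀), hp₀, hq₀, hpq₀⟩
  refine ⟨p, q, hp, hq, hpq, fun e hpe heq => ?_⟩
  have hcp := Finset.card_le_card hpe.2
  have hcq := Finset.card_le_card heq.2
  rcases h.2 e.map (hp ▸ map_le hpe) (hq ▸ map_le heq) with he | he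
  · have := hmin (e, q) ⟨he, hq, heq⟩
    dsimp only at this
    rcases eq_or_ne e.lower.card q.lower.card with hc | hc
    · exact Or.inr (ext heq.1 (Finset.eq_of_subset_of_card_le heq.2 hc.ge))
    · exact Or.inl (ext hpe.1.symm (Finset.eq_of_subset_of_card_le hpe.2 (by omega)).symm)
  · have := hmin (p, e) ⟨hp, he, hpe⟩
    dsimp only at this
    rcases eq_or_ne e.lower.card p.lower.card with hc | hc
    · exact Or.inl (ext hpe.1.symm (Finset.eq_of_subset_of_card_le hpe.2 hc.le).symm)
    · exact Or.inr (ext heq.1 (Finset.eq_of_subset_of_card_le heq.2 (by omega)))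

theorem hasse_symm {a b : C.Cell n} (h : a.Hasse b) : b.Hasse a :=
  h.elim (fun h => Or.inl h.symm) fun h => Or.inr h.symm

/-- Every edge is a bridge: after deleting the edge from `a` to its successor `b`, no walk leaves
the set of cells below or equal to `a`. -/
theorem isAcyclic_hasse : (SimpleGraph.fromRel (Hasse : C.Cell n → C.Cell n → Prop)).IsAcyclic := by
  have main : ∀ a b : C.Cell n, a ≠ b → a.Consec b →
      (SimpleGraph.fromRel (Hasse : C.Cell n → C.Cell n → Prop)).IsBridge s(a, b) := by
    intro a b hab h
    rw [SimpleGraph.isBridge_iff]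
    rintro ⟨w⟩
    have inv : ∀ u v : C.Cell n, ((SimpleGraph.fromRel Hasse).deleteEdges {s(a, b)}).Walk u v →
        u.le a → v.le a := by
      intro u v w
      induction w with
      | nil => exact id
      | @cons u v x huv _ ih =>
        intro hua
        refine ih ?_
        rw [SimpleGraph.deleteEdges_adj, SimpleGraph.fromRel_adj] at huv
        obtain ⟨⟨hne, huv⟩, hedge⟩ := huv
        rcases huv.elim id hasse_symm with rfl | huv | hvu
        · exact hua
        · rcases lower_total v a with hva | hav
          · exact ⟨huv.1.1.symm.trans hua.1, hva⟩
          · rcases huv.2 a hua ⟨hua.1.symm.trans huv.1.1, hav⟩ with rfl | rfl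
            · exfalso
              have hva : v.piece = a.piece := huv.1.1.symm
              rcases lower_total v b with hvb | hbv
              · rcases h.2 v huv.1 ⟨hva.trans h.1.1, hvb⟩ with rfl | rfl
                · exact hne rfl
                · exact hedge rfl
              · rcases huv.2 b h.1 ⟨(hva.trans h.1.1).symm, hbv⟩ with rfl | rfl
                · exact hab rfl
                · exact hedge rfl
            · exact le_refl _
        · exact le_trans hvu.1 hua
    exact hab (le_antisymm h.1 (inv a b w (le_refl a)))
  rw [SimpleGraph.isAcyclic_iff_forall_adj_isBridge]
  intro a b hab
  rw [SimpleGraph.fromRel_adj] at hab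
  rcases hab.2.elim id hasse_symm with h | h | h
  · exact absurd h hab.1
  · exact main a b hab.1 h
  · rw [Sym2.eq_swap]
    exact main b a hab.1.symm h

theorem eq_of_isMaxChain {B : Set (C.Cell n)} (hB : IsMaxChain le B) {a : C.Cell n} (ha : a ∈ B) :
    B = {b | b.piece = a.piece} := by
  have hle : B ⊆ {b | b.piece = a.piece} := fun b hb => by
    rcases hB.1.total hb ha with h | h
    exacts [h.1, h.1.symm]
  refine hB.2 (fun b hb b' hb' _ => ?_) hle
  have : b.piece = b'.piece := Eq.trans hb (Eq.symm hb')
  exact (lower_total b b').imp (fun h => ⟨this, h⟩) fun h => ⟨this.symm, h⟩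

end Cell

end Cuts

/-! ### The projective sequence and the point given by a thread -/

namespace Cuts

variable {Y : Type*} [TopologicalSpace Y] [CompactSpace Y] (C : Cuts Y)

/-- The structure of the cells of the `n`-th partition. -/
noncomputable def stage (n : ℕ) : TopStructure.{0} :=
  letI : TopologicalSpace (C.Cell n) := ⊥
  haveI : DiscreteTopology (C.Cell n) := ⟨rfl⟩
  haveI : Finite (C.Cell n) := Cell.finite
  { carrier := C.Cell n
    zeroDim := isTopologicalBasis_isClopen
    R := Cell.Hasse
    le := Cell.le
    isClosed_R := isClosed_discrete _
    isClosed_le := isClosed_discrete _ }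

instance (n : ℕ) : DiscreteTopology (C.stage n) := ⟨rfl⟩

instance (n : ℕ) : Finite (C.stage n) := Cell.finite (C := C)

theorem memF₀_stage (n : ℕ) : (C.stage n).MemF₀ where
  partialOrder :=
    { refl := Cell.le_refl (C := C)
      trans := fun _ _ _ => Cell.le_trans (C := C)
      antisymm := fun _ _ => Cell.le_antisymm (C := C) }
  R_iff _ _ := Iff.rfl
  acyclic := Cell.isAcyclic_hasse
  finite := inferInstance
  disjoint_chains := fun _ _ hB hB' hne => disjoint_left.2 fun _ ha ha' => hne
    ((Cell.eq_of_isMaxChain (C := C) hB ha).trans (Cell.eq_of_isMaxChain (C := C) hB' ha').symm)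

/-- The projective sequence of the structures of cells. -/
noncomputable def seq : ProjSequence.{0} where
  P := C.stage
  map _ := Cell.map (C := C)
  epi n :=
    { continuous := continuous_of_discreteTopology
      surjective := Cell.map_surjective
      R_iff := fun b b' => by
        constructor
        · rintro (h | h | h)
          · obtain ⟨a, rfl⟩ := Cell.map_surjective b
            exact ⟨a, a, rfl, h, Or.inl rfl⟩
          · obtain ⟨p, q, hp, hq, hpq⟩ := Cell.Consec.exists_lift h
            exact ⟨p, q, hp, hq, Or.inr (Or.inl hpq)⟩
          · obtain ⟨p, q, hp, hq, hpq⟩ := Cell.Consec.exists_lift h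
            exact ⟨q, p, hq, hp, Or.inr (Or.inr hpq)⟩
        · rintro ⟨a, a', rfl, rfl, rfl | h | h⟩
          · exact Or.inl rfl
          · exact Or.inr (Or.inl (Cell.Consec.map h))
          · exact Or.inr (Or.inr (Cell.Consec.map h))
      le_iff := fun b b' => by
        constructor
        · intro h
          exact Cell.exists_le_of_le h
        · rintro ⟨a, a', rfl, rfl, h⟩
          exact Cell.map_le h }

variable {C}

/-- The `n`-th coordinate of a point of the limit, as a cell. -/
noncomputable def coord (n : ℕ) (u : C.seq.limit) : C.Cell n := C.seq.proj n u

theorem coord_succ (n : ℕ) (u : C.seq.limit) : (coord (n + 1) u).map = coord n u :=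
  (Subtype.property u n).symm

theorem isOpen_coord_eq (n : ℕ) (a : C.Cell n) : IsOpen {u : C.seq.limit | coord n u = a} :=
  (isOpen_discrete (α := C.stage n) {a}).preimage
    ((continuous_apply n).comp (continuous_subtype_val (p := fun w => w ∈ C.seq.limitSet)))

theorem isClosed_coord_eq (n : ℕ) (a : C.Cell n) : IsClosed {u : C.seq.limit | coord n u = a} :=
  (isClosed_discrete (α := C.stage n) {a}).preimage
    ((continuous_apply n).comp (continuous_subtype_val (p := fun w => w ∈ C.seq.limitSet)))

theorem coord_eq_of_le {m n : ℕ} (hmn : m ≤ n) {u v : C.seq.limit} (h : coord n u = coord n v) :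
    coord m u = coord m v := by
  induction n, hmn using Nat.le_induction with
  | base => exact h
  | succ n _ ih => exact ih (by rw [← coord_succ, h, coord_succ])

theorem exists_coord_subset {u : C.seq.limit} {W : Set C.seq.limit} (hW : IsOpen W) (hu : u ∈ W) :
    ∃ n, ∀ v, coord n v = coord n u → v ∈ W := by
  obtain ⟨V, hV, rfl⟩ : ∃ V : Set (∀ n, C.seq.P n), IsOpen V ∧ Subtype.val ⁻¹' V = W :=
    isOpen_induced_iff.1 hW
  obtain ⟨F, s, hs, hsV⟩ := isOpen_pi_iff.1 hV _ hu
  refine ⟨F.sup id, fun v hv => hsV fun n hn => ?_⟩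
  have : coord n v = coord n u := coord_eq_of_le (Finset.le_sup (f := id) hn) hv
  change coord n v ∈ s n
  rw [this]
  exact (hs n hn).2

theorem exists_coord_eq (a : ∀ n, C.Cell n) (ha : ∀ n, (a (n + 1)).map = a n) :
    ∃ u : C.seq.limit, ∀ n, coord n u = a n :=
  ⟨⟨a, fun n => (ha n).symm⟩, fun _ => rfl⟩

namespace Cell

/-- The closed set of points of `Y` described by a cell. -/
def points {n : ℕ} (a : C.Cell n) : Set Y :=
  {y | C.c n y = a.piece ∧ ∀ i < n, (i ∈ a.lower → C.t i ≤ C.f y) ∧ (i ∉ a.lower → C.f y ≤ C.t i)}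

/-- The open set of points of `Y` described by a cell. -/
def openPoints {n : ℕ} (a : C.Cell n) : Set Y :=
  {y | C.c n y = a.piece ∧ ∀ i < n, (i ∈ a.lower → C.t i < C.f y) ∧ (i ∉ a.lower → C.f y < C.t i)}

variable {n : ℕ}

omit [CompactSpace Y]

theorem isClosed_points (a : C.Cell n) : IsClosed a.points := by
  refine ((C.isLocallyConstant_c n).isClosed_fiber a.piece).inter ?_
  change IsClosed {y | ∀ i < n, (i ∈ a.lower → C.t i ≤ C.f y) ∧ (i ∉ a.lower → C.f y ≤ C.t i)}
  simp only [ofPred_forall]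
  refine isClosed_iInter fun i => isClosed_iInter fun _ => ?_
  by_cases h : i ∈ a.lower
  · simpa [h] using isClosed_le continuous_const C.continuous_f
  · simpa [h] using isClosed_le C.continuous_f continuous_const

theorem isOpen_openPoints (a : C.Cell n) : IsOpen a.openPoints := by
  refine ((C.isLocallyConstant_c n).isOpen_fiber a.piece).inter ?_
  have : {y | ∀ i < n, (i ∈ a.lower → C.t i < C.f y) ∧ (i ∉ a.lower → C.f y < C.t i)} =
      ⋂ i ∈ {i | i < n}, {y | (i ∈ a.lower → C.t i < C.f y) ∧ (i ∉ a.lower → C.f y < C.t i)} := by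
    ext y; simp
  change IsOpen {y | ∀ i < n, (i ∈ a.lower → C.t i < C.f y) ∧ (i ∉ a.lower → C.f y < C.t i)}
  rw [this]
  refine (finite_lt_nat n).isOpen_biInter fun i _ => ?_
  by_cases h : i ∈ a.lower
  · simpa [h] using isOpen_lt continuous_const C.continuous_f
  · simpa [h] using isOpen_lt C.continuous_f continuous_const

theorem mem_openPoints_iff {y : Y} (hy : C.Regular y) {a : C.Cell n} :
    y ∈ a.openPoints ↔ cellOf n hy = a := by
  constructor
  · rintro ⟨hc, h⟩
    refine ext hc (Finset.ext fun i => ?_)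
    change i ∈ C.below n y ↔ _
    rw [mem_below]
    refine ⟨fun ⟨hi, hlt⟩ => ?_, fun hi => ⟨lt_of_mem_lower hi, (h i (lt_of_mem_lower hi)).1 hi⟩⟩
    by_contra hia
    exact ((h i hi).2 hia).not_gt hlt
  · rintro rfl
    refine ⟨rfl, fun i hi => ⟨fun h => (C.mem_below.1 h).2, fun h => ?_⟩⟩
    refine lt_of_le_of_ne (le_of_not_gt fun hlt => h (C.mem_below.2 ⟨hi, hlt⟩)) fun heq => ?_
    exact hy ⟨i, heq.symm⟩

theorem openPoints_subset_points (a : C.Cell n) : a.openPoints ⊆ a.points :=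
  fun _ h => ⟨h.1, fun i hi => ⟨fun hia => ((h.2 i hi).1 hia).le, fun hia => ((h.2 i hi).2 hia).le⟩⟩

theorem mem_openPoints_of_mem_points {y : Y} (hy : C.Regular y) {a : C.Cell n}
    (h : y ∈ a.points) : y ∈ a.openPoints :=
  ⟨h.1, fun i hi => ⟨fun hia => ((h.2 i hi).1 hia).lt_of_ne fun heq => hy ⟨i, heq⟩,
    fun hia => ((h.2 i hi).2 hia).lt_of_ne fun heq => hy ⟨i, heq.symm⟩⟩⟩

theorem points_nonempty (a : C.Cell n) : a.points.Nonempty := by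
  obtain ⟨y, hy, rfl⟩ := exists_cellOf_eq a
  exact ⟨y, openPoints_subset_points _ ((mem_openPoints_iff hy).2 rfl)⟩

theorem points_subset_map (a : C.Cell (n + 1)) : a.points ⊆ a.map.points := by
  rintro y ⟨hc, h⟩
  refine ⟨(C.c_eq n y).trans (congrArg (C.parent n) hc), fun i hi => ?_⟩
  have hmem : i ∈ a.map.lower ↔ i ∈ a.lower :=
    Finset.mem_filter.trans (and_iff_left hi)
  rw [hmem]
  exact h i (hi.trans n.lt_succ_self)

/-- Every level between the two cells passes through `y`, so an intermediate cell equals the lower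
or the upper one according to the side of `y` on which its regular point lies. -/
theorem hasse_of_mem_points {a b : C.Cell n} {y : Y} (ha : y ∈ a.points) (hb : y ∈ b.points) :
    a.Hasse b := by
  have main : ∀ a b : C.Cell n, y ∈ a.points → y ∈ b.points → a.lower ⊆ b.lower →
      a.Consec b := by
    refine fun a b ha hb hab => ⟨⟨ha.1.symm.trans hb.1, hab⟩, fun e hae heb => ?_⟩
    obtain ⟨z, hz, rfl⟩ := exists_cellOf_eq e
    rcases le_or_gt (C.f z) (C.f y) with hzy | hyz
    · refine Or.inl (ext hae.1.symm (Finset.Subset.antisymm (fun i hi => ?_) hae.2))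
      obtain ⟨hin, hiz⟩ := C.mem_below.1 hi
      by_contra hia
      exact (hiz.trans_le hzy).not_ge ((ha.2 i hin).2 hia)
    · refine Or.inr (ext heb.1 (heb.2.antisymm fun i hi => C.mem_below.2 ?_))
      have hin := lt_of_mem_lower hi
      exact ⟨hin, ((hb.2 i hin).1 hi).trans_lt hyz⟩
  rcases lower_total a b with h | h
  · exact Or.inr (Or.inl (main a b ha hb h))
  · exact Or.inr (Or.inr (main b a hb ha h))

end Cell

theorem exists_mem_points (u : C.seq.limit) : ∃ y, ∀ n, y ∈ (coord n u).points := by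
  obtain ⟨y, hy⟩ := IsCompact.nonempty_iInter_of_sequence_nonempty_isCompact_isClosed
    (fun n => (coord n u).points) (fun n => by
      simpa only [coord_succ] using (coord (n + 1) u).points_subset_map)
    (fun n => Cell.points_nonempty _) (Cell.isClosed_points _).isCompact
    fun n => Cell.isClosed_points _
  exact ⟨y, mem_iInter.1 hy⟩

/-- The point of `Y` described by a point of the limit. -/
noncomputable def point (u : C.seq.limit) : Y := (exists_mem_points u).choose

theorem point_mem (u : C.seq.limit) (n : ℕ) : point u ∈ (coord n u).points :=
  (exists_mem_points u).choose_spec n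

theorem f_le_of_lower_subset {u v : C.seq.limit} {x y : Y}
    (h : ∀ n, (coord n u).lower ⊆ (coord n v).lower) (hx : ∀ n, x ∈ (coord n u).points)
    (hy : ∀ n, y ∈ (coord n v).points) : C.f x ≤ C.f y := by
  by_contra! hlt
  obtain ⟨i, hyi, hix⟩ := C.dense_t _ _ hlt
  by_cases hi : i ∈ (coord (i + 1) u).lower
  · exact (((hy (i + 1)).2 i i.lt_succ_self).1 (h _ hi)).not_gt hyi
  · exact (((hx (i + 1)).2 i i.lt_succ_self).2 hi).not_gt hix

theorem component_eq_of_piece_eq {u v : C.seq.limit} {x y : Y}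
    (h : ∀ n, (coord n u).piece = (coord n v).piece) (hx : ∀ n, x ∈ (coord n u).points)
    (hy : ∀ n, y ∈ (coord n v).points) : connectedComponent x = connectedComponent y :=
  C.component_eq x y fun n => (hx n).1.trans ((h n).trans (hy n).1.symm)

theorem point_eq {u : C.seq.limit} {y : Y} (h : ∀ n, y ∈ (coord n u).points) : point u = y :=
  C.eq_of_f_eq _ _ (component_eq_of_piece_eq (fun _ => rfl) (point_mem u) h)
    ((f_le_of_lower_subset (fun _ => subset_rfl) (point_mem u) h).antisymm
      (f_le_of_lower_subset (fun _ => subset_rfl) h (point_mem u)))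

/-- If the heights differed, two of the dense levels would lie strictly between them and would
separate the coordinates at a late stage, whereas consecutive cells are separated by at most one
height. -/
theorem limit_R_iff (u v : C.seq.limit) : C.seq.limit.R u v ↔ point u = point v := by
  refine ⟨fun h => ?_, fun h n => ?_⟩
  · have hR : ∀ n, (coord n u).Hasse (coord n v) := h
    have hpiece : ∀ n, (coord n u).piece = (coord n v).piece := fun n => by
      rcases hR n with h | h | h
      exacts [congrArg _ h, h.1.1, h.1.1.symm]
    have main : ∀ u v : C.seq.limit, (∀ n, (coord n u).Hasse (coord n v)) →
        C.f (point v) ≤ C.f (point u) := by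
      intro u v hR
      by_contra! hlt
      obtain ⟨i, hui, hiv⟩ := C.dense_t _ _ hlt
      obtain ⟨j, hij, hjv⟩ := C.dense_t _ _ hiv
      have hnu : ∀ k, C.f (point u) < C.t k → ∀ n, k ∉ (coord n u).lower := fun k hk n hkn =>
        (((point_mem u n).2 k (Cell.lt_of_mem_lower hkn)).1 hkn).not_gt hk
      have hnv : ∀ k, C.t k < C.f (point v) → ∀ n, k < n → k ∈ (coord n v).lower :=
        fun k hk n hkn => by
          by_contra hkv
          exact (((point_mem v n).2 k hkn).2 hkv).not_gt hk
      obtain ⟨n, hin, hjn⟩ : ∃ n, i < n ∧ j < n := ⟨i + j + 1, by omega, by omega⟩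
      have hiu := hnu i hui n
      have hiv := hnv i hiv n hin
      rcases hR n with h | h | h
      · exact hiu (h ▸ hiv)
      · exact h.not_level_lt hiu hiv (hnu j (hui.trans hij) n) (hnv j hjv n hjn) hij
      · exact hiu (h.1.2 hiv)
    exact C.eq_of_f_eq _ _ (component_eq_of_piece_eq hpiece (point_mem u) (point_mem v))
      ((main v u fun n => Cell.hasse_symm (hR n)).antisymm (main u v hR))
  · exact Cell.hasse_of_mem_points (point_mem u n) (h ▸ point_mem v n)

theorem isPrespace_limit : C.seq.limit.IsPrespace where
  refl u := (limit_R_iff u u).2 rfl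
  symm h := (limit_R_iff _ _).2 ((limit_R_iff _ _).1 h).symm
  trans h h' := (limit_R_iff _ _).2 (((limit_R_iff _ _).1 h).trans ((limit_R_iff _ _).1 h'))

theorem isFine : C.seq.IsFine := ⟨fun n => inferInstanceAs (Finite (C.stage n)), isPrespace_limit⟩

end Cuts

/-! ### The quotient of the limit -/

namespace Cuts

variable {Y : Type*} [TopologicalSpace Y] [CompactSpace Y] {C : Cuts Y}

theorem continuous_point [T2Space Y] : Continuous (point : C.seq.limit → Y) := by
  rw [continuous_iff_isClosed]
  intro K hK
  rw [← isOpen_compl_iff, isOpen_iff_mem_nhds]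
  intro u hu
  have hempty : ⋂ n, (coord n u).points ∩ K = ∅ := by
    rw [eq_empty_iff_forall_notMem]
    intro y hy
    rw [← iInter_inter] at hy
    refine hu ?_
    rw [mem_preimage, point_eq (mem_iInter.1 hy.1)]
    exact hy.2
  obtain ⟨n, hn⟩ : ∃ n, (coord n u).points ∩ K = ∅ := by
    by_contra! h
    refine (IsCompact.nonempty_iInter_of_sequence_nonempty_isCompact_isClosed
      (fun n => (coord n u).points ∩ K) (fun n => ?_) h
      ((Cell.isClosed_points _).inter hK).isCompact
      fun n => (Cell.isClosed_points _).inter hK).ne_empty hempty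
    refine inter_subset_inter_left _ ?_
    simpa only [coord_succ] using (coord (n + 1) u).points_subset_map
  filter_upwards [(isOpen_coord_eq n (coord n u)).mem_nhds rfl] with v hv hvK
  have hv' : coord n v = coord n u := hv
  have : point v ∈ (coord n u).points ∩ K := ⟨hv' ▸ point_mem v n, hvK⟩
  rw [hn] at this
  exact this

theorem exists_coord_eq_cellOf {y : Y} (hy : C.Regular y) :
    ∃ u : C.seq.limit, (∀ n, coord n u = cellOf n hy) ∧ point u = y := by
  obtain ⟨u, hu⟩ := exists_coord_eq (fun n => cellOf n hy) fun n => Cell.map_cellOf hy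
  exact ⟨u, hu, point_eq fun n => Cell.openPoints_subset_points _
    ((Cell.mem_openPoints_iff hy).2 (hu n).symm)⟩

theorem coord_eq_cellOf {u : C.seq.limit} (hu : C.Regular (point u)) (n : ℕ) :
    coord n u = cellOf n hu :=
  ((Cell.mem_openPoints_iff hu).1 (Cell.mem_openPoints_of_mem_points hu (point_mem u n))).symm

theorem image_coord_subset {n : ℕ} (a : C.Cell n) :
    point '' {u : C.seq.limit | coord n u = a} ⊆ a.points := by
  rintro _ ⟨u, rfl, rfl⟩
  exact point_mem u n

/-- Regular points are dense in the open cell and come from their own threads; the image is compact,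
hence closed. -/
theorem openPoints_subset_image [T2Space Y] {n : ℕ} (a : C.Cell n) :
    a.openPoints ⊆ point '' {u : C.seq.limit | coord n u = a} := by
  have hcl : IsClosed (point '' {u : C.seq.limit | coord n u = a}) :=
    ((isClosed_coord_eq n a).isCompact.image continuous_point).isClosed
  refine (C.dense_regular.open_subset_closure_inter (Cell.isOpen_openPoints a)).trans
    (closure_minimal ?_ hcl)
  rintro y ⟨hya, hy⟩
  obtain ⟨u, hu, rfl⟩ := exists_coord_eq_cellOf (C := C) hy
  exact ⟨u, (hu n).trans ((Cell.mem_openPoints_iff hy).1 hya), rfl⟩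

theorem point_surjective [T2Space Y] : Function.Surjective (point : C.seq.limit → Y) := by
  have hcl : IsClosed (range (point : C.seq.limit → Y)) :=
    (isCompact_range continuous_point).isClosed
  refine range_eq_univ.1 (univ_subset_iff.1 ?_)
  rw [← C.dense_regular.closure_eq]
  refine closure_minimal (fun y hy => ?_) hcl
  obtain ⟨u, -, hu⟩ := exists_coord_eq_cellOf (C := C) hy
  exact ⟨u, hu⟩

/-- Follow the cells just above `x` and those just below `y` along their component. A level through
`x` thus counts as below the first thread, while one through `y` does not count as below the second.
-/
theorem exists_limit_le_of_lt {x y : Y} (h : connectedComponent x = connectedComponent y)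
    (hlt : C.f x < C.f y) : ∃ u v : C.seq.limit, C.seq.limit.le u v ∧ point u = x ∧ point v = y := by
  classical
  have hup : ∀ n, ∃ b ≤ C.f y, C.f x < b ∧ ∀ i < n, C.f x < C.t i → b ≤ C.t i := fun n => by
    obtain ⟨b, hb, hbmin⟩ := Finset.exists_min_image (insert (C.f y)
      (((Finset.range n).filter fun k => C.f x < C.t k).image C.t)) id (Finset.insert_nonempty _ _)
    refine ⟨b, hbmin _ (Finset.mem_insert_self _ _), ?_, fun k hk hki =>
      hbmin _ (Finset.mem_insert_of_mem (Finset.mem_image_of_mem _ (by simp [hk, hki])))⟩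
    rcases Finset.mem_insert.1 hb with rfl | hb
    · exact hlt
    · obtain ⟨k, hk, rfl⟩ := Finset.mem_image.1 hb
      exact (Finset.mem_filter.1 hk).2
  have hdown : ∀ n, ∃ a ≥ C.f x, a < C.f y ∧ ∀ i < n, C.t i < C.f y → C.t i ≤ a := fun n => by
    obtain ⟨a, ha, hamax⟩ := Finset.exists_max_image (insert (C.f x)
      (((Finset.range n).filter fun k => C.t k < C.f y).image C.t)) id (Finset.insert_nonempty _ _)
    refine ⟨a, hamax _ (Finset.mem_insert_self _ _), ?_, fun k hk hki =>
      hamax _ (Finset.mem_insert_of_mem (Finset.mem_image_of_mem _ (by simp [hk, hki])))⟩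
    rcases Finset.mem_insert.1 ha with rfl | ha
    · exact hlt
    · obtain ⟨k, hk, rfl⟩ := Finset.mem_image.1 ha
      exact (Finset.mem_filter.1 hk).2
  have hz : ∀ n, ∃ z, C.Regular z ∧ C.c n z = C.c n x ∧ ∀ i < n, C.t i < C.f z ↔ C.t i ≤ C.f x :=
    fun n => by
      obtain ⟨b, hby, hxb, hb⟩ := hup n
      obtain ⟨z, hzx, hz1, hz2, hz⟩ := exists_mem_connectedComponent_of_lt C.continuous_f
        (countable_range C.t) h hxb le_rfl hby
      refine ⟨z, hz, C.c_eq_of_component hzx, fun i hi =>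
        ⟨fun hiz => ?_, fun hix => hix.trans_lt hz1⟩⟩
      by_contra! hxi
      exact (hiz.trans hz2).not_ge (hb i hi hxi)
  have hw : ∀ n, ∃ w, C.Regular w ∧ C.c n w = C.c n x ∧ ∀ i < n, C.t i < C.f w ↔ C.t i < C.f y :=
    fun n => by
      obtain ⟨a, hax, hay, ha⟩ := hdown n
      obtain ⟨w, hwx, hw1, hw2, hw⟩ := exists_mem_connectedComponent_of_lt C.continuous_f
        (countable_range C.t) h hay hax le_rfl
      exact ⟨w, hw, C.c_eq_of_component hwx, fun i hi =>
        ⟨fun hiw => hiw.trans hw2, fun hiy => (ha i hi hiy).trans_lt hw1⟩⟩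
  choose z hz hzc hzt using hz
  choose w hw hwc hwt using hw
  have hbz : ∀ n i, i ∈ C.below n (z n) ↔ i < n ∧ C.t i ≤ C.f x := fun n i => by
    rw [mem_below]; exact and_congr_right (hzt n i)
  have hbw : ∀ n i, i ∈ C.below n (w n) ↔ i < n ∧ C.t i < C.f y := fun n i => by
    rw [mem_below]; exact and_congr_right (hwt n i)
  have hmap : ∀ s : ℕ → Y, ∀ hs : ∀ n, C.Regular (s n), (∀ n, C.c n (s n) = C.c n x) →
      ∀ p : ℕ → Prop, (∀ n i, i ∈ C.below n (s n) ↔ i < n ∧ p i) → ∃ u : C.seq.limit, ∀ n,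
        coord n u = cellOf n (hs n) := fun s hs hsc p hp => by
    refine exists_coord_eq _ fun n => Cell.ext ?_ (Finset.ext fun i => ?_)
    · change C.parent n (C.c (n + 1) (s (n + 1))) = C.c n (s n)
      rw [hsc, hsc, ← C.c_eq]
    · change i ∈ (C.below (n + 1) (s (n + 1))).filter (· < n) ↔ i ∈ C.below n (s n)
      rw [Finset.mem_filter, hp, hp]
      grind
  obtain ⟨u, hu⟩ := hmap z hz hzc _ hbz
  obtain ⟨v, hv⟩ := hmap w hw hwc _ hbw
  refine ⟨u, v, fun n => ?_, point_eq fun n => ?_, point_eq fun n => ?_⟩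
  · change (coord n u).le (coord n v)
    rw [hu, hv]
    refine ⟨(hzc n).trans (hwc n).symm, fun i hi => ?_⟩
    obtain ⟨hin, hix⟩ := (hbz n i).1 hi
    exact (hbw n i).2 ⟨hin, hix.trans_lt hlt⟩
  · rw [hu]
    refine ⟨(hzc n).symm, fun i hi => ⟨fun hiz => ((hbz n i).1 hiz).2, fun hiz => ?_⟩⟩
    exact le_of_not_ge fun hix => hiz ((hbz n i).2 ⟨hi, hix⟩)
  · rw [hv]
    refine ⟨(C.c_eq_of_component h.symm).trans (hwc n).symm, fun i hi =>
      ⟨fun hiw => ((hbw n i).1 hiw).2.le, fun hiw => ?_⟩⟩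
    exact le_of_not_gt fun hiy => hiw ((hbw n i).2 ⟨hi, hiy⟩)

theorem limit_le_point {u v : C.seq.limit} (h : C.seq.limit.le u v) :
    connectedComponent (point u) = connectedComponent (point v) ∧ C.f (point u) ≤ C.f (point v) := by
  have hle : ∀ n, (coord n u).le (coord n v) := h
  exact ⟨component_eq_of_piece_eq (fun n => (hle n).1) (point_mem u) (point_mem v),
    f_le_of_lower_subset (fun n => (hle n).2) (point_mem u) (point_mem v)⟩

/-- Every basic open set of threads contains the unique thread over some regular point, and `K` must
contain that thread. -/
theorem eq_univ_of_forall_exists_point_eq [T2Space Y] {K : Set C.seq.limit} (hK : IsClosed K)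
    (h : ∀ u : C.seq.limit, ∃ v ∈ K, point v = point u) : K = univ := by
  by_contra hne
  obtain ⟨u, hu⟩ := (ne_univ_iff_exists_notMem K).1 hne
  obtain ⟨n, hn⟩ := exists_coord_subset hK.isOpen_compl hu
  obtain ⟨x, hx, hxu⟩ := exists_cellOf_eq (coord n u)
  obtain ⟨w, hw, rfl⟩ := exists_coord_eq_cellOf (C := C) hx
  obtain ⟨v, hvK, hvw⟩ := h w
  refine hn v ?_ hvK
  have hv : C.Regular (point v) := hvw ▸ hx
  rw [coord_eq_cellOf hv, ← hxu]
  simp only [hvw]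

variable (C) in
/-- The homeomorphism between the quotient of the limit and the space. -/
noncomputable def quotHomeomorph [T2Space Y] : C.seq.limit.QuotSpace isFine.2 ≃ₜ Y :=
  haveI : CompactSpace (C.seq.limit.QuotSpace isFine.2) := Quotient.compactSpace
  Continuous.homeoOfEquivCompactToT2
    (f := Equiv.ofBijective (Quotient.lift point fun u v h => (limit_R_iff u v).1 h)
      ⟨fun x y => Quotient.inductionOn₂ x y fun u v h => Quotient.sound ((limit_R_iff u v).2 h),
        fun y => (point_surjective (C := C) y).elim fun u hu => ⟨Quotient.mk _ u, hu⟩⟩)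
    (continuous_point.quotient_lift _)

theorem quotHomeomorph_image_cell [T2Space Y] {n : ℕ} (a : C.Cell n) :
    C.quotHomeomorph '' C.seq.cell isFine n a = point '' {u : C.seq.limit | coord n u = a} :=
  image_image _ _ _

theorem mem_interior_cell_iff [T2Space Y] {n : ℕ} (a : C.Cell n)
    (x : C.seq.limit.QuotSpace isFine.2) : x ∈ interior (C.seq.cell isFine n a) ↔
      C.quotHomeomorph x ∈ interior (point '' {u : C.seq.limit | coord n u = a}) := by
  rw [← quotHomeomorph_image_cell, ← C.quotHomeomorph.image_interior,
    C.quotHomeomorph.injective.mem_set_image]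

theorem cell_le_iff [T2Space Y] {n : ℕ} (a b : C.Cell n) : a.le b ↔
    ∃ x ∈ interior (point '' {u : C.seq.limit | coord n u = a}),
      ∃ y ∈ interior (point '' {u : C.seq.limit | coord n u = b}),
        connectedComponent x = connectedComponent y ∧ C.f x ≤ C.f y := by
  constructor
  · intro h
    obtain ⟨x, y, hx, hy, hxy, hf, hxa, hyb⟩ := Cell.exists_regular_of_le h
    have hint : ∀ a : C.Cell n, a.openPoints ⊆ interior (point '' {u : C.seq.limit | coord n u = a}) :=
      fun a => interior_maximal (openPoints_subset_image a) (Cell.isOpen_openPoints a)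
    exact ⟨x, hint _ ((Cell.mem_openPoints_iff hx).2 hxa), y,
      hint _ ((Cell.mem_openPoints_iff hy).2 hyb), hxy, hf⟩
  · rintro ⟨x, hx, y, hy, hxy, hf⟩
    have hxa := image_coord_subset a (interior_subset hx)
    have hyb := image_coord_subset b (interior_subset hy)
    refine ⟨hxa.1.symm.trans ((C.c_eq_of_component hxy).trans hyb.1), fun i hia => ?_⟩
    by_contra hib
    have hin := Cell.lt_of_mem_lower hia
    have hix := (hxa.2 i hin).1 hia
    have hyi := (hyb.2 i hin).2 hib
    -- Both points have height `C.t i`, so they coincide and the two interiors overlap; a regular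
    -- point of the overlap would also have to lie on that level.
    obtain rfl := C.eq_of_f_eq x y hxy (hf.antisymm (hyi.trans hix))
    obtain ⟨z, ⟨hza, hzb⟩, hz⟩ := C.dense_regular.inter_open_nonempty _
      (isOpen_interior.inter isOpen_interior) ⟨x, hx, hy⟩
    have hza := image_coord_subset a (interior_subset hza)
    have hzb := image_coord_subset b (interior_subset hzb)
    exact hz ⟨i, ((hza.2 i hin).1 hia).antisymm ((hzb.2 i hin).2 hib)⟩

end Cuts

end HasseFence

theorem mainTheorem3 {Y : Type*} [TopologicalSpace Y] (hY : HasseFence.IsSmoothFence Y)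
    (r : Y → Y → Prop) (hr : HasseFence.IsStronglyCompatibleOrder r) :
    ∃ (S : HasseFence.ProjSequence.{0}) (h : S.IsFine),
      (∀ n, (S.P n).MemF₀) ∧
      S.Approximates h Y ∧
      HasseFence.IsIrreducibleMap (S.limit.proj h.2) ∧
      ∃ g : S.limit.QuotSpace h.2 ≃ₜ Y,
        (∀ x y, S.limit.quotLE h.2 x y ↔ r (g x) (g y)) ∧
        ∀ (n : ℕ) (a a' : S.P n), (S.P n).le a a' ↔
          ∃ x ∈ interior (S.cell h n a), ∃ x' ∈ interior (S.cell h n a'), r (g x) (g x') := by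
  have := hY.1.compact
  have := hY.1.metrizable
  have : SecondCountableTopology Y := by
    let := metrizableSpaceMetric Y
    infer_instance
  obtain ⟨C, hC⟩ := HasseFence.exists_cuts hr
  refine ⟨C.seq, HasseFence.Cuts.isFine, C.memF₀_stage,
    ⟨hY.1.compact, hY.1.metrizable, ⟨C.quotHomeomorph⟩⟩,
    ⟨continuous_quotient_mk', fun K hK hne himage => hne ?_⟩, C.quotHomeomorph,
    fun x y => ?_, fun n a a' => ?_⟩
  · refine HasseFence.Cuts.eq_univ_of_forall_exists_point_eq hK fun u => ?_
    obtain ⟨v, hv, hvu⟩ : C.seq.limit.proj HasseFence.Cuts.isFine.2 u ∈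
      C.seq.limit.proj HasseFence.Cuts.isFine.2 '' K := himage ▸ mem_univ _
    exact ⟨v, hv, congrArg C.quotHomeomorph hvu⟩
  · rw [hC]
    constructor
    · rintro ⟨u, v, rfl, rfl, huv⟩
      exact HasseFence.Cuts.limit_le_point huv
    · rintro ⟨hxy, hf⟩
      rcases hf.eq_or_lt with heq | hlt
      · obtain rfl := C.quotHomeomorph.injective (C.eq_of_f_eq _ _ hxy heq)
        obtain ⟨u, rfl⟩ := Quotient.exists_rep x
        exact ⟨u, u, rfl, rfl, fun n => HasseFence.Cuts.Cell.le_refl (C := C) _⟩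
      · obtain ⟨u, v, huv, hu, hv⟩ := HasseFence.Cuts.exists_limit_le_of_lt hxy hlt
        exact ⟨u, v, C.quotHomeomorph.injective hu, C.quotHomeomorph.injective hv, huv⟩
  · refine (HasseFence.Cuts.cell_le_iff (C := C) a a').trans ?_
    have hint := fun (a : C.Cell n) x => HasseFence.Cuts.mem_interior_cell_iff (C := C) a x
    simp only [hC]
    constructor
    · rintro ⟨x, hx, y, hy, h⟩
      obtain ⟨x, rfl⟩ := C.quotHomeomorph.surjective x
      obtain ⟨y, rfl⟩ := C.quotHomeomorph.surjective y
      exact ⟨x, (hint a x).2 hx, y, (hint a' y).2 hy, h⟩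
    · rintro ⟨x, hx, y, hy, h⟩
      exact ⟨_, (hint a x).1 hx, _, (hint a' y).1 hy, h⟩
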